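/- Let $N\ge 1$ and let $H=(h_{\ell k})$ be a real symmetric $N\times N$ Wigner matrix: $h_{\ell k}=h_{k\ell}=N^{-1/2}x_{\ell k}$, where the random variables $x_{\ell k}$, $\ell\le k$, are independent, the off-diagonal ones $x_{\ell k}$ ($\ell<k$) have a common distribution $\nu$ with mean $0$ and variance $1$, and the diagonal ones $x_{\ell\ell}$ have a common distribution $\widetilde\nu$ with mean $0$ and variance $2$. For an interval $I\subset\mathbb R$ of finite length $|I|$ let $\mathcal N_I$ be the number of eigenvalues of $H$ in $I$, counted with multiplicity. (a) Let $\theta$ be a real number, and suppose that both $\nu$ and $\widetilde\nu$ satisfy the logarithmic Sobolev inequality with constant $\theta$: for $\rho\in\{\nu,\widetilde\nu\}$, $$\int u\log u\,d\rho\le\theta\int|(\sqrt u)'|^2\,d\rho$$ for all $u\ge 0$ on $\mathbb R$ with $\int u\,d\rho=1$ such that $\sqrt u$ is continuously differentiable and the right-hand integral is finite (the left-hand side then being finite too). Then there exist positive constants $C$, $c$, $K_0$, depending only on $\theta$ (and not on $N$, $I$, $K$, $\nu$, $\widetilde\nu$), such that whenever $|I|\ge(\log N)^2/N$, $$\mathbb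 P\big(\mathcal N_I\ge KN|I|\big)\le C e^{-c\sqrt{KN|I|}}\qquad\text{for all }K\ge K_0 .$$ (b) The same conclusion holds if, instead of the logarithmic Sobolev inequality, one assumes only Gaussian decay, i.e. $\int e^{\delta_0x^2}\,d\nu(x)\le D$ and $\int e^{\delta_0x^2}\,d\widetilde\nu(x)\le D$ for some $\delta_0>0$ and $D<\infty$; the constants $C$, $c$, $K_0$ then depend only on $\delta_0$ and $D$. -/

import Mathlib

open MeasureTheory ProbabilityTheory

namespace WignerUpper

/-- The measure `ν` on `ℝ` has a finite second moment, expectation zero and variance `v`. -/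
structure IsCenteredWithVariance (ν : Measure ℝ) (v : ℝ) : Prop where
  memLp : MemLp (fun x : ℝ => x) 2 ν
  mean : ∫ x, x ∂ν = 0
  variance : ∫ x, x ^ 2 ∂ν = v

/-- The logarithmic Sobolev inequality with constant `θ`:
`∫ u log u dν ≤ θ ∫ |(√u)'|² dν` for every `u ≥ 0` with `∫ u dν = 1`.
The admissible `u` are those for which `√u` is continuously differentiable; when the right-hand
side is infinite nothing is asserted, and when it is finite the left-hand side (whose integrand is
bounded below) is asserted to be finite too.  At `u x = 0` the value `u log u = 0` is the usual
convention. -/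
def LogSobolev (ν : Measure ℝ) (θ : ℝ) : Prop :=
  ∀ u : ℝ → ℝ, (∀ x, 0 ≤ u x) → ContDiff ℝ 1 (fun x => √(u x)) →
    Integrable u ν → ∫ x, u x ∂ν = 1 →
    Integrable (fun x => (deriv (fun y => √(u y)) x) ^ 2) ν →
    Integrable (fun x => u x * Real.log (u x)) ν ∧
      ∫ x, u x * Real.log (u x) ∂ν ≤ θ * ∫ x, (deriv (fun y => √(u y)) x) ^ 2 ∂ν

/-- Gaussian decay: `∫ exp (δ₀ x²) dν(x)` is finite and at most `D`. -/
def GaussianDecay (ν : Measure ℝ) (δ₀ D : ℝ) : Prop :=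
  Integrable (fun x : ℝ => Real.exp (δ₀ * x ^ 2)) ν ∧ ∫ x, Real.exp (δ₀ * x ^ 2) ∂ν ≤ D

/-- The (unnormalised) entries of an `N × N` symmetric Wigner matrix, indexed by the unordered
pairs `s(i, j)` (equivalently, by `i ≤ j`): they are independent, the off-diagonal ones have
law `ν` and the diagonal ones have law `νd`. -/
structure IsWignerFamily {Ω : Type*} [MeasurableSpace Ω] (P : Measure Ω) (ν νd : Measure ℝ)
    (N : ℕ) (x : Sym2 (Fin N) → Ω → ℝ) : Prop where
  indep : iIndepFun x P
  law_offDiag : ∀ i j : Fin N, i ≠ j → HasLaw (x s(i, j)) ν P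
  law_diag : ∀ i : Fin N, HasLaw (x s(i, i)) νd P

/-- The symmetric matrix `H = (h_{ij})` with `h_{ij} = N^{-1/2} x_{ij}`. -/
noncomputable def wignerMatrix {N : ℕ} (x : Sym2 (Fin N) → ℝ) : Matrix (Fin N) (Fin N) ℝ :=
  Matrix.of fun i j => (√(N : ℝ))⁻¹ * x s(i, j)

theorem wignerMatrix_isHermitian {N : ℕ} (x : Sym2 (Fin N) → ℝ) :
    (wignerMatrix x).IsHermitian := by
  ext i j
  simp [wignerMatrix, Matrix.conjTranspose_apply, Sym2.eq_swap]

/-- The number of eigenvalues, counted with multiplicity, of `wignerMatrix x` that lie in `I`. -/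
noncomputable def eigenvalueCount {N : ℕ} (x : Sym2 (Fin N) → ℝ) (I : Set ℝ) : ℕ :=
  Set.ncard {k : Fin N | (wignerMatrix_isHermitian x).eigenvalues k ∈ I}

end WignerUpper

/-! Let `E` be the midpoint of `I`, `η = |I|/2`, `R = H - E`, and let `n` be the number of
eigenvalues in `I`. The matrix `L(R) = η²/(R² + η²)` lies between 0 and 1 and is at least 1/2 on the
eigenvectors counted, so `n ≤ 2 tr L(R)`. A Schur complement bounds its diagonal: if `a` is the
`k`-th column without its diagonal entry and `B` is the `k`-th minor, then `L(R)_kk (η² + a·L(B)a) ≤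
η²` (`lorentz_diag_le`). Interlacing gives `tr L(B) ≥ (n - 1)/2`. Since `a` is independent of `B`
and has entries of variance `1/N`, the form `a·L(B)a` should be about `tr L(B)/N`. If it is at least
a quarter of that for every `k`, summing over `k` yields `n(n - 1) ≤ 4(N|I|)²`. Hence, for `K ≥ 4`
and `m = KN|I| > 2`, a count `n ≥ m` forces some column to have an abnormally small form although
its trace is at least `(m - 1)/2`.

Only the lower tail of a nonnegative quadratic form is needed, and it follows from the one-sided
Laplace bound `𝔼 exp(-l b·Ab) ≤ exp(-(l/2) tr A)` for `0 ≤ A ≤ 1` and small `l`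
(`lintegral_exp_neg_quadraticForm_le`). A union bound then gives `N exp(-l(m - 1)/8)`, and `|I| ≥
(log N)²/N` makes `log N` at most a small multiple of `√m`.

The law of the entries enters through `∫ exp(βx) dν ≤ M exp(Mβ²)`, together with mean 0 and variance
1. Gaussian decay gives this by completing a square, the logarithmic Sobolev inequality by Herbst's
argument. -/

namespace WignerUpper

/-! ### Laplace transform of a single entry -/

/-- Two-sided exponential moments with Gaussian growth, both constants being `M`. -/
def SubgaussianBound (ν : Measure ℝ) (M : ℝ) : Prop :=
  ∀ β : ℝ, Integrable (fun x => Real.exp (β * x)) ν ∧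
    ∫ x, Real.exp (β * x) ∂ν ≤ M * Real.exp (M * β ^ 2)

theorem exp_le_one_add_add_sq_mul_exp {f g : ℝ} (h : f ≤ g) (hg : 0 ≤ g) :
    Real.exp f ≤ 1 + f + f ^ 2 * Real.exp g := by
  have hg1 : 1 ≤ Real.exp g := Real.one_le_exp hg
  rcases le_total f 1 with h1 | h1
  · rcases le_total (-1) f with h2 | h2
    · have := Real.abs_exp_sub_one_sub_id_le (abs_le.2 ⟨h2, h1⟩)
      have := (abs_le.1 this).2
      nlinarith [sq_nonneg f]
    · have : Real.exp f ≤ 1 := Real.exp_le_one_iff.2 (by linarith)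
      nlinarith [sq_nonneg f]
  · have : Real.exp f ≤ Real.exp g := Real.exp_le_exp.2 h
    have : Real.exp g ≤ f ^ 2 * Real.exp g := le_mul_of_one_le_left (Real.exp_pos g).le (by nlinarith)
    linarith

theorem pow_four_add_sq_le (b : ℝ) : b ^ 4 + b ^ 2 ≤ 26 * Real.exp |b| := by
  have h4 := Real.pow_div_factorial_le_exp |b| (abs_nonneg b) 4
  have h2 := Real.pow_div_factorial_le_exp |b| (abs_nonneg b) 2
  have e4 : |b| ^ 4 = b ^ 4 := by
    rw [show 4 = 2 * 2 from rfl, pow_mul, sq_abs, pow_mul]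
  rw [e4] at h4
  rw [sq_abs] at h2
  norm_num [Nat.factorial] at h4 h2
  linarith

theorem exp_two_abs_le (b : ℝ) :
    Real.exp (2 * |b|) ≤ Real.exp (2 * b) + Real.exp (-2 * b) := by
  rcases abs_cases b with ⟨h, _⟩ | ⟨h, _⟩ <;> rw [h]
  · linarith [Real.exp_pos (-2 * b)]
  · have : 2 * -b = -2 * b := by ring
    rw [this]; linarith [Real.exp_pos (2 * b)]

/-- A second-order Taylor bound that survives `-α b²` being unbounded below: the exponent never
exceeds `|b|`, so the remainder carries only a factor `exp |b|`. Another `exp |b|` absorbs `b⁴ +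
b²`, with `26 = 4! + 2!`. -/
theorem exp_neg_sq_add_le {α β b : ℝ} (hα : 0 ≤ α) (hβ : |β| ≤ 1) :
    Real.exp (-α * b ^ 2 + β * b) ≤ 1 + (-α * b ^ 2 + β * b) +
      52 * (α ^ 2 + β ^ 2) * (Real.exp (2 * b) + Real.exp (-2 * b)) := by
  have hle : -α * b ^ 2 + β * b ≤ |b| := by
    have : β * b ≤ |β| * |b| := by rw [← abs_mul]; exact le_abs_self _
    nlinarith [abs_nonneg b, sq_nonneg b, mul_nonneg hα (sq_nonneg b)]
  have h1 := exp_le_one_add_add_sq_mul_exp hle (abs_nonneg b)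
  have h2 : (-α * b ^ 2 + β * b) ^ 2 ≤ 2 * (α ^ 2 + β ^ 2) * (b ^ 4 + b ^ 2) := by
    nlinarith [sq_nonneg (α * b ^ 2 + β * b), sq_nonneg (α * b), sq_nonneg (β * b ^ 2)]
  have h3 := pow_four_add_sq_le b
  have h4 := exp_two_abs_le b
  have h5 : Real.exp (2 * |b|) = Real.exp |b| * Real.exp |b| := by
    rw [← Real.exp_add]; ring_nf
  have h0 : 0 ≤ 2 * (α ^ 2 + β ^ 2) := by positivity
  calc _ ≤ _ := h1
    _ ≤ 1 + (-α * b ^ 2 + β * b) +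
        (2 * (α ^ 2 + β ^ 2) * (26 * Real.exp |b|)) * Real.exp |b| := by
      gcongr
      exact h2.trans (by gcongr)
    _ = 1 + (-α * b ^ 2 + β * b) + 52 * (α ^ 2 + β ^ 2) * Real.exp (2 * |b|) := by
      rw [h5]; ring
    _ ≤ _ := by gcongr

/-- The constant governing the one-dimensional Laplace transform bound. -/
noncomputable def laplaceConst (M : ℝ) : ℝ := 104 * M * Real.exp (4 * M) + 2 * M + 1

theorem one_le_laplaceConst {M : ℝ} (hM : 1 ≤ M) : 1 ≤ laplaceConst M := by
  unfold laplaceConst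
  have : 0 ≤ 104 * M * Real.exp (4 * M) := by positivity
  linarith

/-- Mean 0 and variance 1 make the first-order part integrate to exactly `-α`; everything else is
quadratic in `(α, β)`. No bound on `β` is imposed, because the induction below uses it with `β`
linear in the remaining coordinates. -/
theorem integral_exp_neg_sq_add_le {ν : Measure ℝ} [IsProbabilityMeasure ν] {M : ℝ} (hM : 1 ≤ M)
    (hν : IsCenteredWithVariance ν 1) (hsub : SubgaussianBound ν M) {α β : ℝ}
    (hα : 0 ≤ α) (hα1 : α ≤ 1) :
    ∫⁻ b, ENNReal.ofReal (Real.exp (-α * b ^ 2 + β * b)) ∂ν ≤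
      ENNReal.ofReal (Real.exp (-α + laplaceConst M * (α ^ 2 + β ^ 2))) := by
  have hp : 0 ≤ 104 * M * Real.exp (4 * M) := by positivity
  have hint : Integrable (fun b => Real.exp (-α * b ^ 2 + β * b)) ν := by
    refine (hsub β).1.mono' (by fun_prop) (Filter.Eventually.of_forall fun b => ?_)
    rw [Real.norm_eq_abs, Real.abs_exp]
    exact Real.exp_le_exp.2 (by nlinarith [mul_nonneg hα (sq_nonneg b)])
  rw [← ofReal_integral_eq_lintegral_ofReal hint
    (Filter.Eventually.of_forall fun b => (Real.exp_pos _).le)]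
  apply ENNReal.ofReal_le_ofReal
  rcases le_total |β| 1 with hβ | hβ
  · have hx : Integrable (fun b : ℝ => b) ν := hν.memLp.integrable one_le_two
    have hx2 : Integrable (fun b : ℝ => b ^ 2) ν := hν.memLp.integrable_sq
    have i1 : Integrable (fun b : ℝ => -α * b ^ 2 + β * b) ν :=
      (hx2.const_mul _).add (hx.const_mul _)
    have i2 : Integrable (fun b : ℝ => 1 + (-α * b ^ 2 + β * b)) ν :=
      (integrable_const _).add i1
    have i3 : Integrable (fun b : ℝ => 52 * (α ^ 2 + β ^ 2) *
        (Real.exp (2 * b) + Real.exp (-2 * b))) ν :=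
      ((hsub 2).1.add (hsub (-2)).1).const_mul _
    have e : ∫ b, (1 + (-α * b ^ 2 + β * b) + 52 * (α ^ 2 + β ^ 2) *
        (Real.exp (2 * b) + Real.exp (-2 * b))) ∂ν = 1 - α + 52 * (α ^ 2 + β ^ 2) *
        (∫ b, Real.exp (2 * b) ∂ν + ∫ b, Real.exp (-2 * b) ∂ν) := by
      rw [integral_add i2 i3, integral_add (integrable_const _) i1,
        integral_add (hx2.const_mul _) (hx.const_mul _), integral_const_mul, integral_const_mul,
        integral_const_mul, integral_add (hsub 2).1 (hsub (-2)).1, hν.mean, hν.variance]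
      simp; ring
    have h1 := integral_mono hint (i2.add i3) fun b => exp_neg_sq_add_le (b := b) hα hβ
    have h2 := (hsub 2).2
    have h3 := (hsub (-2)).2
    rw [show M * (2 : ℝ) ^ 2 = 4 * M by ring] at h2
    rw [show M * (-2 : ℝ) ^ 2 = 4 * M by ring] at h3
    calc _ ≤ _ := h1
      _ = _ := e
      _ ≤ 1 - α + 52 * (α ^ 2 + β ^ 2) * (M * Real.exp (4 * M) + M * Real.exp (4 * M)) := by
        gcongr
      _ ≤ (-α + laplaceConst M * (α ^ 2 + β ^ 2)) + 1 := by
        unfold laplaceConst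
        nlinarith [sq_nonneg α, sq_nonneg β]
      _ ≤ _ := Real.add_one_le_exp _
  -- For `|β| ≥ 1` the crude bound without `-α b²` suffices: `M + Mβ² + α ≤ (2M + 1)β²`, which
  -- explains the summand `2M + 1` of `laplaceConst`.
  · have hβ2 : 1 ≤ β ^ 2 := by rw [← sq_abs]; nlinarith
    have hMexp : M ≤ Real.exp M := by linarith [Real.add_one_le_exp M]
    calc _ ≤ ∫ b, Real.exp (β * b) ∂ν := by
          refine integral_mono hint (hsub β).1 fun b => Real.exp_le_exp.2 ?_
          nlinarith [mul_nonneg hα (sq_nonneg b)]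
      _ ≤ M * Real.exp (M * β ^ 2) := (hsub β).2
      _ ≤ Real.exp M * Real.exp (M * β ^ 2) := by gcongr
      _ = Real.exp (M + M * β ^ 2) := by rw [Real.exp_add]
      _ ≤ _ := by
        apply Real.exp_le_exp.2
        unfold laplaceConst
        nlinarith [mul_nonneg hp (add_nonneg (sq_nonneg α) (sq_nonneg β)), sq_nonneg α,
          mul_nonneg (by linarith : 0 ≤ M) (sq_nonneg α)]

/-! ### Laplace transform of a quadratic form -/

open Matrix in
-- Coordinates are integrated out one at a time. The cross term with the first coordinate acts as a
-- linear tilt; its quadratic cost is absorbed by a rank-one correction of the remaining form, which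
-- preserves `0 ≤ A ≤ 1` and loses little trace.
theorem lintegral_exp_neg_quadraticForm_le {ν : Measure ℝ} [IsProbabilityMeasure ν] {C l : ℝ}
    (hl : 0 ≤ l) (hl1 : l ≤ 1) (hCl : 10 * C * l ≤ 1) (hC : 0 ≤ C)
    (hlap : ∀ α β : ℝ, 0 ≤ α → α ≤ 1 →
      ∫⁻ b, ENNReal.ofReal (Real.exp (-α * b ^ 2 + β * b)) ∂ν ≤
        ENNReal.ofReal (Real.exp (-α + C * (α ^ 2 + β ^ 2)))) :
    ∀ (n : ℕ) (A : Matrix (Fin n) (Fin n) ℝ), A.IsSymm → (∀ x, 0 ≤ x ⬝ᵥ A *ᵥ x) →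
      (∀ x, x ⬝ᵥ A *ᵥ x ≤ x ⬝ᵥ x) →
      ∫⁻ b, ENNReal.ofReal (Real.exp (-(l * (b ⬝ᵥ A *ᵥ b)))) ∂(Measure.pi fun _ : Fin n => ν) ≤
        ENNReal.ofReal (Real.exp (-(l / 2 * A.trace))) := by
  intro n
  induction n with
  | zero => intro A _ _ _; simp
  | succ n ih =>
    intro A hA h0 h1
    set a : Fin n → ℝ := fun j => A 0 j.succ with ha
    set A₁ : Matrix (Fin n) (Fin n) ℝ := A.submatrix Fin.succ Fin.succ with hA₁
    set d : ℝ := A 0 0 with hd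
    have key : ∀ (t : ℝ) (y : Fin n → ℝ), (Fin.cons t y : Fin (n + 1) → ℝ) ⬝ᵥ
        A *ᵥ (Fin.cons t y : Fin (n + 1) → ℝ) =
        d * t ^ 2 + 2 * t * (a ⬝ᵥ y) + y ⬝ᵥ A₁ *ᵥ y := by
      intro t y
      have hsym : ∀ i : Fin n, A i.succ 0 = A 0 i.succ := fun i => hA.apply _ _
      simp only [dotProduct, mulVec, Fin.sum_univ_succ, Fin.cons_zero, Fin.cons_succ, hA₁,
        submatrix_apply, hsym, ha, hd, mul_add, Finset.sum_add_distrib]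
      have : ∑ i : Fin n, y i * (A 0 i.succ * t) = t * ∑ i : Fin n, A 0 i.succ * y i := by
        rw [Finset.mul_sum]; exact Finset.sum_congr rfl fun i _ => by ring
      rw [this]; ring
    have norm_cons : ∀ (t : ℝ) (y : Fin n → ℝ), (Fin.cons t y : Fin (n + 1) → ℝ) ⬝ᵥ
        (Fin.cons t y : Fin (n + 1) → ℝ) = t ^ 2 + y ⬝ᵥ y := by
      intro t y
      simp [dotProduct, Fin.sum_univ_succ, sq]
    have P0 : ∀ t y, 0 ≤ d * t ^ 2 + 2 * t * (a ⬝ᵥ y) + y ⬝ᵥ A₁ *ᵥ y := fun t y =>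
      key t y ▸ h0 _
    have P1 : ∀ t y, d * t ^ 2 + 2 * t * (a ⬝ᵥ y) + y ⬝ᵥ A₁ *ᵥ y ≤ t ^ 2 + y ⬝ᵥ y := fun t y =>
      key t y ▸ norm_cons t y ▸ h1 _
    have hd0 : 0 ≤ d := by simpa using P0 1 0
    have hd1 : d ≤ 1 := by simpa using P1 1 0
    have hA₁le : ∀ y, y ⬝ᵥ A₁ *ᵥ y ≤ y ⬝ᵥ y := fun y => by simpa using P1 0 y
    -- Test vector `(-1, a)`: `0 ≤ d - 2|a|² + a·A₁a ≤ d - |a|²`.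
    have haa : a ⬝ᵥ a ≤ d := by
      have := P0 (-1) a
      have := hA₁le a
      linarith
    have haa0 : 0 ≤ a ⬝ᵥ a := by
      simp only [dotProduct]; exact Finset.sum_nonneg fun i _ => mul_self_nonneg _
    have hCl0 : 0 ≤ C * l := mul_nonneg hC hl
    -- The tilt `β = -2l(a·y)` costs `Cβ² = l · 4Cl(a·y)²`, which is exactly what this correction
    -- removes.
    set A₂ : Matrix (Fin n) (Fin n) ℝ := A₁ - (4 * C * l) • vecMulVec a a with hA₂
    have qA₂ : ∀ y, y ⬝ᵥ A₂ *ᵥ y = y ⬝ᵥ A₁ *ᵥ y - 4 * C * l * (a ⬝ᵥ y) ^ 2 := by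
      intro y
      rw [hA₂, sub_mulVec, dotProduct_sub, smul_mulVec, dotProduct_smul, vecMulVec_mulVec,
        smul_eq_mul]
      simp only [dotProduct_smul, dotProduct_comm y a, MulOpposite.smul_eq_mul_unop,
        MulOpposite.unop_op]
      ring
    have trA₂ : A₂.trace = A.trace - d - 4 * C * l * (a ⬝ᵥ a) := by
      rw [hA₂, trace_sub, trace_smul, trace_vecMulVec, smul_eq_mul]
      congr 1
      simp [trace, Fin.sum_univ_succ, hA₁, hd]
    have step := ih A₂ (by
        rw [hA₂]
        refine IsSymm.sub (hA.submatrix _) (IsSymm.smul ?_ _)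
        ext i j; simp [vecMulVec_apply, mul_comm]) (fun y => by
        rw [qA₂]
        -- This gives `y·A₁y ≥ (2 - d)(a·y)² ≥ (a·y)²`, more than the `4Cl(a·y)²` subtracted.
        have := P0 (-(a ⬝ᵥ y)) y
        nlinarith [sq_nonneg (a ⬝ᵥ y)]) (fun y => by
        rw [qA₂]
        have := hA₁le y
        nlinarith [sq_nonneg (a ⬝ᵥ y)])
    have mp := measurePreserving_piFinSuccAbove (fun _ : Fin (n + 1) => ν) 0
    rw [← mp.symm.lintegral_comp (by
      simp only [dotProduct, mulVec]; fun_prop)]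
    rw [lintegral_prod_symm' _ (by
      simp only [dotProduct, mulVec]
      refine Measurable.ennreal_ofReal (Real.measurable_exp.comp ?_)
      refine Measurable.neg (Measurable.const_mul ?_ _)
      exact Measurable.comp (g := fun b : Fin (n + 1) → ℝ => ∑ i, b i * ∑ j, A i j * b j)
        (by fun_prop) (MeasurableEquiv.measurable _))]
    calc _ ≤ ∫⁻ y, ENNReal.ofReal (Real.exp (-(l * d) + C * (l * d) ^ 2)) *
          ENNReal.ofReal (Real.exp (-(l * (y ⬝ᵥ A₂ *ᵥ y)))) ∂(Measure.pi fun _ : Fin n => ν) := by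
          refine lintegral_mono fun y => ?_
          have e : ∀ t : ℝ, ENNReal.ofReal (Real.exp (-(l *
              ((MeasurableEquiv.piFinSuccAbove (fun _ => ℝ) 0).symm (t, y) ⬝ᵥ
                A *ᵥ (MeasurableEquiv.piFinSuccAbove (fun _ => ℝ) 0).symm (t, y))))) =
              ENNReal.ofReal (Real.exp (-(l * (y ⬝ᵥ A₁ *ᵥ y)))) * ENNReal.ofReal
                (Real.exp (-(l * d) * t ^ 2 + (-(2 * l * (a ⬝ᵥ y))) * t)) := by
            intro t
            rw [← ENNReal.ofReal_mul (Real.exp_pos _).le, ← Real.exp_add]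
            have : ((MeasurableEquiv.piFinSuccAbove (fun _ : Fin (n + 1) => ℝ) 0).symm (t, y)) =
              (Fin.cons t y : Fin (n + 1) → ℝ) := by
              simp [MeasurableEquiv.piFinSuccAbove, Fin.insertNthEquiv]
            rw [this, key]
            congr 2; ring
          simp_rw [e]
          rw [lintegral_const_mul _ (by fun_prop)]
          refine (mul_le_mul_right (hlap (l * d) (-(2 * l * (a ⬝ᵥ y))) (mul_nonneg hl hd0)
            (by nlinarith)) _).trans_eq ?_
          rw [← ENNReal.ofReal_mul (Real.exp_pos _).le, ← ENNReal.ofReal_mul (Real.exp_pos _).le,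
            ← Real.exp_add, ← Real.exp_add, qA₂]
          congr 2; ring
      _ = ENNReal.ofReal (Real.exp (-(l * d) + C * (l * d) ^ 2)) *
          ∫⁻ y, ENNReal.ofReal (Real.exp (-(l * (y ⬝ᵥ A₂ *ᵥ y)))) ∂(Measure.pi fun _ : Fin n => ν) :=
          lintegral_const_mul _ (by simp only [dotProduct, mulVec]; fun_prop)
      _ ≤ ENNReal.ofReal (Real.exp (-(l * d) + C * (l * d) ^ 2)) *
          ENNReal.ofReal (Real.exp (-(l / 2 * A₂.trace))) := by gcongr
      _ ≤ _ := by
        rw [← ENNReal.ofReal_mul (Real.exp_pos _).le, ← Real.exp_add, trA₂]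
        apply ENNReal.ofReal_le_ofReal
        apply Real.exp_le_exp.2
        -- Half of `-ld` restores the trace term. The other half pays for `C(ld)²` and for the lost
        -- trace `2Cl²|a|²`, together at most `3Cl²d ≤ 3ld/10`.
        have k1 : C * (l * d) ^ 2 ≤ C * l * l * d := by
          have : d ^ 2 ≤ d := by nlinarith
          nlinarith [mul_nonneg hCl0 hl]
        have k2 : 2 * (C * l) * l * (a ⬝ᵥ a) ≤ 2 * (C * l) * l * d := by gcongr
        have k3 : C * l * l * d ≤ 1 / 10 * l * d := by
          have := mul_nonneg hl hd0
          nlinarith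
        nlinarith [mul_nonneg hl hd0]

/-! ### Subgaussian bounds from Gaussian decay and from the logarithmic Sobolev inequality -/

theorem subgaussianBound_of_gaussianDecay {ν : Measure ℝ} {δ₀ D : ℝ} (hδ : 0 < δ₀)
    (h : GaussianDecay ν δ₀ D) : SubgaussianBound ν (max 1 (max D (1 / (4 * δ₀)))) := by
  intro β
  set M := max 1 (max D (1 / (4 * δ₀)))
  have hle : ∀ x : ℝ, Real.exp (β * x) ≤ Real.exp (M * β ^ 2) * Real.exp (δ₀ * x ^ 2) := by
    intro x
    rw [← Real.exp_add]
    apply Real.exp_le_exp.2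
    have h1 : 1 / (4 * δ₀) * β ^ 2 ≤ M * β ^ 2 := by
      gcongr
      exact (le_max_right _ _).trans (le_max_right _ _)
    have h2 : 1 / (4 * δ₀) * β ^ 2 + δ₀ * x ^ 2 - β * x = δ₀ * (x - β / (2 * δ₀)) ^ 2 := by
      field_simp; ring
    nlinarith [mul_nonneg hδ.le (sq_nonneg (x - β / (2 * δ₀)))]
  have hint : Integrable (fun x : ℝ => Real.exp (β * x)) ν := by
    refine (h.1.const_mul (Real.exp (M * β ^ 2))).mono' (by fun_prop)
      (Filter.Eventually.of_forall fun x => ?_)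
    rw [Real.norm_eq_abs, Real.abs_exp]
    exact hle x
  refine ⟨hint, ?_⟩
  calc _ ≤ ∫ x, Real.exp (M * β ^ 2) * Real.exp (δ₀ * x ^ 2) ∂ν :=
        integral_mono hint (h.1.const_mul _) hle
    _ = Real.exp (M * β ^ 2) * ∫ x, Real.exp (δ₀ * x ^ 2) ∂ν := integral_const_mul _ _
    _ ≤ Real.exp (M * β ^ 2) * M := by
      gcongr
      exact h.2.trans ((le_max_left _ _).trans (le_max_right _ _))
    _ = _ := mul_comm _ _

theorem LogSobolev.mono {ν : Measure ℝ} {θ θ' : ℝ} (h : LogSobolev ν θ) (hθ : θ ≤ θ') :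
    LogSobolev ν θ' := by
  intro u h0 h1 h2 h3 h4
  obtain ⟨h5, h6⟩ := h u h0 h1 h2 h3 h4
  refine ⟨h5, h6.trans ?_⟩
  gcongr

theorem integrable_exp_mul_of_abs_le {ν : Measure ℝ} [IsProbabilityMeasure ν] {f : ℝ → ℝ} {B : ℝ}
    (hf : Continuous f) (hB : ∀ x, |f x| ≤ B) (s : ℝ) :
    Integrable (fun x => Real.exp (s * f x)) ν := by
  refine Integrable.of_bound (by fun_prop) (Real.exp (|s| * B))
    (Filter.Eventually.of_forall fun x => ?_)
  rw [Real.norm_eq_abs, Real.abs_exp]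
  apply Real.exp_le_exp.2
  calc s * f x ≤ |s * f x| := le_abs_self _
    _ = |s| * |f x| := abs_mul _ _
    _ ≤ _ := by gcongr; exact hB x

/-- The inequality is applied to the tilted density `u = exp(s f)/Z`, for which `|(√u)'|² = (s²/4)
f'² u`. -/
theorem LogSobolev.entropy_exp_le {ν : Measure ℝ} [IsProbabilityMeasure ν] {θ : ℝ} (hθ : 0 ≤ θ)
    (h : LogSobolev ν θ) {f : ℝ → ℝ} {B : ℝ} (hf : ContDiff ℝ 1 f) (hB : ∀ x, |f x| ≤ B)
    (hd : ∀ x, |deriv f x| ≤ 1) (s : ℝ) :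
    s * (∫ x, f x * Real.exp (s * f x) ∂ν) / mgf f ν s - Real.log (mgf f ν s) ≤
      θ * (s ^ 2 / 4) := by
  have hint := integrable_exp_mul_of_abs_le (ν := ν) hf.continuous hB s
  have hZ : 0 < mgf f ν s := mgf_pos hint
  set Z := mgf f ν s with hZdef
  have hZ' : ∫ x, Real.exp (s * f x) ∂ν = Z := rfl
  set u : ℝ → ℝ := fun x => Real.exp (s * f x) / Z with hu
  have hu0 : ∀ x, 0 ≤ u x := fun x => by positivity
  have hsqrt : (fun x => √(u x)) = fun x => Real.exp (s / 2 * f x) * (√Z)⁻¹ := by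
    funext x
    rw [hu]
    simp only
    rw [Real.sqrt_div (Real.exp_pos _).le, div_eq_mul_inv, Real.sqrt_eq_iff_mul_self_eq_of_pos
      (Real.exp_pos _) |>.2]
    rw [← Real.exp_add]; ring_nf
  have hdiff : Differentiable ℝ f := hf.differentiable one_ne_zero
  have hderiv : ∀ x, (deriv (fun y => √(u y)) x) ^ 2 = s ^ 2 / 4 * (deriv f x) ^ 2 * u x := by
    intro x
    have h1 : HasDerivAt (fun y => Real.exp (s / 2 * f y) * (√Z)⁻¹)
        (Real.exp (s / 2 * f x) * (s / 2 * deriv f x) * (√Z)⁻¹) x :=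
      (((hdiff x).hasDerivAt.const_mul (s / 2)).exp).mul_const _
    have h2 : √(u x) = Real.exp (s / 2 * f x) * (√Z)⁻¹ := congrFun hsqrt x
    have h3 : (√(u x)) ^ 2 = u x := Real.sq_sqrt (hu0 x)
    rw [hsqrt, h1.deriv, ← h3, h2]
    ring
  have hui : Integrable u ν := hint.div_const _
  have hu1 : ∫ x, u x ∂ν = 1 := by
    rw [hu, integral_div, hZ', div_self hZ.ne']
  have hdle : ∀ x, (deriv (fun y => √(u y)) x) ^ 2 ≤ s ^ 2 / 4 * u x := by
    intro x
    rw [hderiv]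
    have h1 : (deriv f x) ^ 2 ≤ 1 := by
      rw [← sq_abs]
      exact pow_le_one₀ (abs_nonneg _) (hd x)
    have h2 : 0 ≤ s ^ 2 / 4 * u x := mul_nonneg (by positivity) (hu0 x)
    nlinarith
  have hdi : Integrable (fun x => (deriv (fun y => √(u y)) x) ^ 2) ν := by
    refine (hui.const_mul (s ^ 2 / 4)).mono' ?_ (Filter.Eventually.of_forall fun x => ?_)
    · exact ((measurable_deriv _).pow_const 2).aestronglyMeasurable
    · rw [Real.norm_eq_abs, abs_of_nonneg (sq_nonneg _)]
      exact hdle x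
  have hC1 : ContDiff ℝ 1 (fun x => √(u x)) := by
    rw [hsqrt]
    fun_prop
  obtain ⟨h1, h2⟩ := h u hu0 hC1 hui hu1 hdi
  have hfi : Integrable (fun x => f x * Real.exp (s * f x)) ν := by
    refine (hint.const_mul B).mono' (by have := hf.continuous; fun_prop)
      (Filter.Eventually.of_forall fun x => ?_)
    rw [norm_mul, Real.norm_eq_abs, Real.norm_eq_abs, Real.abs_exp]
    gcongr
    exact hB x
  have hlog : (fun x => u x * Real.log (u x)) =
      fun x => s / Z * (f x * Real.exp (s * f x)) - Real.log Z * u x := by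
    funext x
    simp only [hu]
    rw [Real.log_div (Real.exp_pos _).ne' hZ.ne', Real.log_exp]
    ring
  rw [hlog, integral_sub (hfi.const_mul _) (hui.const_mul _), integral_const_mul,
    integral_const_mul, hu1, mul_one] at h2
  calc _ = s / Z * (∫ x, f x * Real.exp (s * f x) ∂ν) - Real.log Z := by ring
    _ ≤ _ := h2
    _ ≤ θ * ∫ x, s ^ 2 / 4 * u x ∂ν := 
      mul_le_mul_of_nonneg_left (integral_mono hdi (hui.const_mul _) hdle) hθ
    _ = _ := by rw [integral_const_mul, hu1, mul_one]

/-- Herbst's argument: the entropy bound says that `log (mgf t)/t - θt/4` is nonincreasing on `t >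
0`, and its limit at `0⁺` is the mean of `f`. -/
theorem LogSobolev.integral_exp_le_of_nonneg {ν : Measure ℝ} [IsProbabilityMeasure ν] {θ : ℝ}
    (hθ : 0 ≤ θ) (h : LogSobolev ν θ) {f : ℝ → ℝ} {B : ℝ} (hf : ContDiff ℝ 1 f)
    (hB : ∀ x, |f x| ≤ B) (hd : ∀ x, |deriv f x| ≤ 1) {s : ℝ} (hs : 0 ≤ s) :
    ∫ x, Real.exp (s * f x) ∂ν ≤ Real.exp (s * ∫ x, f x ∂ν + θ / 4 * s ^ 2) := by
  rcases hs.eq_or_lt with rfl | hs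
  · simp
  have hint := fun t => integrable_exp_mul_of_abs_le (ν := ν) hf.continuous hB t
  have hset : integrableExpSet f ν = Set.univ := Set.eq_univ_of_forall fun t => hint t
  have hpos : ∀ t, 0 < mgf f ν t := fun t => mgf_pos (hint t)
  have hmgf : ∀ t, HasDerivAt (mgf f ν) (∫ x, f x * Real.exp (t * f x) ∂ν) t := fun t =>
    hasDerivAt_mgf (by simp [hset])
  have hlog : ∀ t, HasDerivAt (fun t => Real.log (mgf f ν t))
      ((∫ x, f x * Real.exp (t * f x) ∂ν) / mgf f ν t) t := fun t => (hmgf t).log (hpos t).ne'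
  set φ : ℝ → ℝ := fun t => Real.log (mgf f ν t) / t - θ / 4 * t with hφ
  have hφd : ∀ t, 0 < t → HasDerivAt φ
      (((∫ x, f x * Real.exp (t * f x) ∂ν) / mgf f ν t * t - Real.log (mgf f ν t) * 1) / t ^ 2
        - θ / 4 * 1) t := fun t ht =>
    ((hlog t).div (hasDerivAt_id t) ht.ne').sub ((hasDerivAt_id t).const_mul _)
  have hanti : AntitoneOn φ (Set.Ioi 0) := by
    refine antitoneOn_of_deriv_nonpos (convex_Ioi 0)
      (fun t ht => (hφd t ht).continuousAt.continuousWithinAt) ?_ ?_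
    · rw [interior_Ioi]
      exact fun t ht => (hφd t ht).differentiableAt.differentiableWithinAt
    · rw [interior_Ioi]
      intro t ht
      rw [(hφd t ht).deriv]
      have h1 := h.entropy_exp_le hθ hf hB hd t
      have ht2 : 0 < t ^ 2 := pow_pos ht 2
      rw [sub_nonpos, div_le_iff₀ ht2]
      calc _ = t * (∫ x, f x * Real.exp (t * f x) ∂ν) / mgf f ν t - Real.log (mgf f ν t) := by ring
        _ ≤ _ := h1
        _ = _ := by ring
  have hlim : Filter.Tendsto φ (nhdsWithin 0 (Set.Ioi 0)) (nhds (∫ x, f x ∂ν)) := by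
    have h1 := (hasDerivAt_iff_tendsto_slope_zero.1 (hlog 0)).mono_left
      (nhdsWithin_mono 0 (fun t (ht : 0 < t) => ht.ne'))
    have h2 : Filter.Tendsto (fun t : ℝ => θ / 4 * t) (nhdsWithin 0 (Set.Ioi 0)) (nhds 0) := by
      have : Filter.Tendsto (fun t : ℝ => θ / 4 * t) (nhds 0) (nhds (θ / 4 * 0)) :=
        (continuous_const.mul continuous_id).tendsto 0
      rw [mul_zero] at this
      exact this.mono_left nhdsWithin_le_nhds
    have h3 := h1.sub h2
    simp only [zero_add, mgf_zero, Real.log_one, sub_zero, smul_eq_mul, zero_mul, Real.exp_zero,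
      mul_one, div_one] at h3
    refine h3.congr fun t => ?_
    simp only [hφ]; ring
  have hle : φ s ≤ ∫ x, f x ∂ν := by
    refine ge_of_tendsto hlim ?_
    filter_upwards [Ioc_mem_nhdsGT hs] with t ht
    exact hanti ht.1 hs ht.2
  have hfin : Real.log (mgf f ν s) ≤ s * ∫ x, f x ∂ν + θ / 4 * s ^ 2 := by
    have h1 : Real.log (mgf f ν s) / s ≤ ∫ x, f x ∂ν + θ / 4 * s := by
      simp only [hφ] at hle; linarith
    rw [div_le_iff₀ hs] at h1
    linarith
  calc _ = Real.exp (Real.log (mgf f ν s)) := (Real.exp_log (hpos s)).symm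
    _ ≤ _ := Real.exp_le_exp.2 hfin

theorem LogSobolev.integral_exp_le {ν : Measure ℝ} [IsProbabilityMeasure ν] {θ : ℝ}
    (hθ : 0 ≤ θ) (h : LogSobolev ν θ) {f : ℝ → ℝ} {B : ℝ} (hf : ContDiff ℝ 1 f)
    (hB : ∀ x, |f x| ≤ B) (hd : ∀ x, |deriv f x| ≤ 1) (s : ℝ) :
    ∫ x, Real.exp (s * f x) ∂ν ≤ Real.exp (s * ∫ x, f x ∂ν + θ / 4 * s ^ 2) := by
  rcases le_total 0 s with hs | hs
  · exact h.integral_exp_le_of_nonneg hθ hf hB hd hs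
  · have := h.integral_exp_le_of_nonneg hθ (f := fun x => -f x) (B := B) hf.neg
      (fun x => by rw [abs_neg]; exact hB x)
      (fun x => by rw [deriv.fun_neg, abs_neg]; exact hd x) (s := -s) (by linarith)
    simpa [integral_neg] using this

/-- A bounded `C¹` approximation of the identity function. -/
noncomputable def arctanTrunc (n : ℕ) (x : ℝ) : ℝ := (n + 1) * Real.arctan (x / (n + 1))

theorem contDiff_arctanTrunc (n : ℕ) : ContDiff ℝ 1 (arctanTrunc n) := by
  unfold arctanTrunc
  exact contDiff_const.mul (Real.contDiff_arctan.comp (contDiff_id.div_const _))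

theorem abs_deriv_arctanTrunc_le (n : ℕ) (x : ℝ) : |deriv (arctanTrunc n) x| ≤ 1 := by
  have hn : (0 : ℝ) < n + 1 := by positivity
  have h1 : HasDerivAt (arctanTrunc n)
      ((n + 1) * (1 / (1 + (x / (n + 1)) ^ 2) * (1 / (n + 1)))) x :=
    (((hasDerivAt_id x).div_const _).arctan).const_mul _
  rw [h1.deriv, show ((n : ℝ) + 1) * (1 / (1 + (x / (n + 1)) ^ 2) * (1 / (n + 1))) =
    1 / (1 + (x / (n + 1)) ^ 2) by field_simp, abs_of_nonneg (by positivity)]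
  rw [div_le_one (by positivity)]
  nlinarith [sq_nonneg (x / (n + 1))]

theorem abs_arctanTrunc_le (n : ℕ) (x : ℝ) : |arctanTrunc n x| ≤ (n + 1) * (Real.pi / 2) := by
  have hn : (0 : ℝ) < n + 1 := by positivity
  rw [arctanTrunc, abs_mul, abs_of_pos hn]
  gcongr
  exact abs_le.2 ⟨(Real.neg_pi_div_two_lt_arctan _).le, (Real.arctan_lt_pi_div_two _).le⟩

theorem abs_arctanTrunc_le_abs (n : ℕ) (x : ℝ) : |arctanTrunc n x| ≤ |x| := by
  have := Convex.norm_image_sub_le_of_norm_deriv_le (f := arctanTrunc n) (s := Set.univ) (C := 1)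
    (x := 0) (y := x) (fun y _ => ((contDiff_arctanTrunc n).differentiable one_ne_zero) y)
    (fun y _ => abs_deriv_arctanTrunc_le n y) convex_univ trivial trivial
  simpa [arctanTrunc] using this

theorem tendsto_arctanTrunc (x : ℝ) :
    Filter.Tendsto (fun n => arctanTrunc n x) Filter.atTop (nhds x) := by
  have h1 : HasDerivAt (fun t : ℝ => Real.arctan (t * x)) (1 / (1 + (0 * x) ^ 2) * (1 * x)) 0 :=
    ((hasDerivAt_id (0 : ℝ)).mul_const x).arctan
  have h2 := hasDerivAt_iff_tendsto_slope_zero.1 h1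
  have h3 : Filter.Tendsto (fun n : ℕ => 1 / ((n : ℝ) + 1)) Filter.atTop
      (nhdsWithin 0 {0}ᶜ) := by
    refine tendsto_nhdsWithin_iff.2 ⟨tendsto_one_div_add_atTop_nhds_zero_nat, ?_⟩
    exact Filter.Eventually.of_forall fun n => by
      have : (n : ℝ) + 1 ≠ 0 := by positivity
      simpa using this
  have h4 := h2.comp h3
  simp only [zero_mul, one_mul] at h4
  norm_num at h4
  refine h4.congr fun n => ?_
  simp [arctanTrunc, div_eq_mul_inv, mul_comm]

/-- Herbst's bound is available for bounded functions, so it is applied to arctangent truncations of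
the identity. Their means tend to 0 by dominated convergence. Fatou's lemma passes the exponential
bound to the limit and also supplies the integrability of `exp(βx)`. -/
theorem subgaussianBound_of_logSobolev {ν : Measure ℝ} [IsProbabilityMeasure ν] {θ v : ℝ}
    (hθ : 0 ≤ θ) (hν : IsCenteredWithVariance ν v) (h : LogSobolev ν θ) :
    SubgaussianBound ν (max 1 (θ / 4)) := by
  intro β
  have hmean : Filter.Tendsto (fun n => ∫ x, arctanTrunc n x ∂ν) Filter.atTop (nhds 0) := by
    rw [← hν.mean]
    have hi : Integrable (fun x : ℝ => |x|) ν := (hν.memLp.integrable one_le_two).abs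
    exact tendsto_integral_of_dominated_convergence _
      (fun n => (contDiff_arctanTrunc n).continuous.aestronglyMeasurable) hi
      (fun n => Filter.Eventually.of_forall fun x => abs_arctanTrunc_le_abs n x)
      (Filter.Eventually.of_forall tendsto_arctanTrunc)
  have hbound : ∀ n, ∫⁻ x, ENNReal.ofReal (Real.exp (β * arctanTrunc n x)) ∂ν ≤
      ENNReal.ofReal (Real.exp (β * ∫ x, arctanTrunc n x ∂ν + θ / 4 * β ^ 2)) := fun n => by
    rw [← ofReal_integral_eq_lintegral_ofReal
      (integrable_exp_mul_of_abs_le (contDiff_arctanTrunc n).continuous (abs_arctanTrunc_le n) β)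
      (Filter.Eventually.of_forall fun b => (Real.exp_pos _).le)]
    exact ENNReal.ofReal_le_ofReal (h.integral_exp_le hθ (contDiff_arctanTrunc n)
      (abs_arctanTrunc_le n) (abs_deriv_arctanTrunc_le n) β)
  have hlim : Filter.Tendsto (fun n => ENNReal.ofReal (Real.exp (β * ∫ x, arctanTrunc n x ∂ν +
      θ / 4 * β ^ 2))) Filter.atTop (nhds (ENNReal.ofReal (Real.exp (θ / 4 * β ^ 2)))) := by
    have h1 := ((hmean.const_mul β).add_const (θ / 4 * β ^ 2))
    rw [mul_zero, zero_add] at h1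
    exact ENNReal.tendsto_ofReal ((Real.continuous_exp.tendsto _).comp h1)
  have hfatou : ∫⁻ x, ENNReal.ofReal (Real.exp (β * x)) ∂ν ≤
      ENNReal.ofReal (Real.exp (θ / 4 * β ^ 2)) := by
    have hpt : ∀ x, Filter.liminf (fun n => ENNReal.ofReal (Real.exp (β * arctanTrunc n x)))
        Filter.atTop = ENNReal.ofReal (Real.exp (β * x)) := fun x =>
      (ENNReal.tendsto_ofReal ((Real.continuous_exp.tendsto _).comp
        ((tendsto_arctanTrunc x).const_mul β))).liminf_eq
    calc _ = ∫⁻ x, Filter.liminf (fun n => ENNReal.ofReal (Real.exp (β * arctanTrunc n x)))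
          Filter.atTop ∂ν := by simp_rw [hpt]
      _ ≤ Filter.liminf (fun n => ∫⁻ x, ENNReal.ofReal (Real.exp (β * arctanTrunc n x)) ∂ν)
          Filter.atTop := lintegral_liminf_le fun n => by
            have := (contDiff_arctanTrunc n).continuous.measurable
            fun_prop
      _ ≤ Filter.liminf (fun n => ENNReal.ofReal (Real.exp (β * ∫ x, arctanTrunc n x ∂ν +
          θ / 4 * β ^ 2))) Filter.atTop :=
            Filter.liminf_le_liminf (Filter.Eventually.of_forall hbound)
      _ = _ := hlim.liminf_eq
  have hint : Integrable (fun x => Real.exp (β * x)) ν := by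
    refine ⟨by fun_prop, ?_⟩
    rw [hasFiniteIntegral_iff_ofReal (Filter.Eventually.of_forall fun x => (Real.exp_pos _).le)]
    exact hfatou.trans_lt ENNReal.ofReal_lt_top
  refine ⟨hint, ?_⟩
  rw [← ofReal_integral_eq_lintegral_ofReal hint
    (Filter.Eventually.of_forall fun b => (Real.exp_pos _).le),
    ENNReal.ofReal_le_ofReal_iff (Real.exp_pos _).le] at hfatou
  calc _ ≤ _ := hfatou
    _ ≤ Real.exp (max 1 (θ / 4) * β ^ 2) := by
      apply Real.exp_le_exp.2
      gcongr
      exact le_max_right _ _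
    _ ≤ _ := le_mul_of_one_le_left (Real.exp_pos _).le (le_max_left _ _)

/-! ### The matrix `η²/(R² + η²)`: variational principle, traces and minors -/

open Matrix

/-- The minor obtained by deleting row and column `k`. -/
def minor {ι : Type*} (R : Matrix ι ι ℝ) (k : ι) : Matrix {j // j ≠ k} {j // j ≠ k} ℝ :=
  R.submatrix Subtype.val Subtype.val

theorem minor_isSymm {ι : Type*} {R : Matrix ι ι ℝ} (hR : R.IsSymm) (k : ι) : (minor R k).IsSymm :=
  hR.submatrix _

theorem _root_.Matrix.IsHermitian.isSymm_sub_smul_one {ι : Type*} [DecidableEq ι] {H : Matrix ι ι ℝ}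
    (hH : H.IsHermitian) (E : ℝ) : (H - E • (1 : Matrix ι ι ℝ)).IsSymm := by
  refine IsSymm.sub ?_ (isSymm_one.smul _)
  simpa [IsHermitian, IsSymm, conjTranspose_eq_transpose_of_trivial] using hH

variable {ι : Type*} [Fintype ι]

theorem dotProduct_mulVec_of_isSymm {R : Matrix ι ι ℝ} (hR : R.IsSymm) (x y : ι → ℝ) :
    x ⬝ᵥ R *ᵥ y = R *ᵥ x ⬝ᵥ y := by
  rw [dotProduct_mulVec, ← mulVec_transpose, hR.eq]

theorem dotProduct_self_nonneg_real (x : ι → ℝ) : 0 ≤ x ⬝ᵥ x :=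
  Finset.sum_nonneg fun i _ => mul_self_nonneg (x i)

variable [DecidableEq ι]

/-- `R² + η²`. -/
def sqAdd (R : Matrix ι ι ℝ) (η : ℝ) : Matrix ι ι ℝ := R * R + η ^ 2 • (1 : Matrix ι ι ℝ)

/-- The matrix `η² / (R² + η²)`, that is `η` times the imaginary part of the resolvent `(R - iη)⁻¹`
of a symmetric matrix `R`. -/
noncomputable def lorentz (R : Matrix ι ι ℝ) (η : ℝ) : Matrix ι ι ℝ := η ^ 2 • (sqAdd R η)⁻¹

theorem sqAdd_isSymm {R : Matrix ι ι ℝ} (hR : R.IsSymm) (η : ℝ) : (sqAdd R η).IsSymm := by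
  unfold sqAdd
  refine IsSymm.add ?_ (isSymm_one.smul _)
  rw [IsSymm, transpose_mul, hR.eq]

theorem lorentz_isSymm {R : Matrix ι ι ℝ} (hR : R.IsSymm) (η : ℝ) : (lorentz R η).IsSymm := by
  unfold lorentz
  refine IsSymm.smul ?_ _
  rw [IsSymm, transpose_nonsing_inv, (sqAdd_isSymm hR η).eq]

theorem dotProduct_sqAdd_mulVec {R : Matrix ι ι ℝ} (hR : R.IsSymm) (η : ℝ) (x y : ι → ℝ) :
    x ⬝ᵥ sqAdd R η *ᵥ y = (R *ᵥ x) ⬝ᵥ (R *ᵥ y) + η ^ 2 * (x ⬝ᵥ y) := by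
  rw [sqAdd, add_mulVec, dotProduct_add, ← mulVec_mulVec, dotProduct_mulVec_of_isSymm hR, smul_mulVec,
    one_mulVec, dotProduct_smul, smul_eq_mul]

theorem isUnit_det_sqAdd {R : Matrix ι ι ℝ} (hR : R.IsSymm) {η : ℝ} (hη : 0 < η) :
    IsUnit (sqAdd R η).det := by
  rw [← isUnit_iff_isUnit_det, ← mulVec_injective_iff_isUnit]
  intro x y hxy
  have h : sqAdd R η *ᵥ (x - y) = 0 := by rw [mulVec_sub, sub_eq_zero]; exact hxy
  have h1 := dotProduct_sqAdd_mulVec hR η (x - y) (x - y)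
  rw [h, dotProduct_zero] at h1
  have h2 := dotProduct_self_nonneg_real (R *ᵥ (x - y))
  have h3 := dotProduct_self_nonneg_real (x - y)
  have h4 : (x - y) ⬝ᵥ (x - y) = 0 := by
    have : 0 < η ^ 2 := by positivity
    by_contra hne
    have := mul_pos this (lt_of_le_of_ne h3 (Ne.symm hne))
    linarith
  exact sub_eq_zero.1 (dotProduct_self_eq_zero.1 h4)

/-- Every vector is `(R² + η²) q`, and then `η² / (R² + η²)` maps it to `η² q`. -/
theorem exists_lorentz_mulVec {R : Matrix ι ι ℝ} (hR : R.IsSymm) {η : ℝ} (hη : 0 < η) (x : ι → ℝ) :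
    ∃ q, sqAdd R η *ᵥ q = x ∧ lorentz R η *ᵥ x = η ^ 2 • q := by
  have h := isUnit_det_sqAdd hR hη
  refine ⟨(sqAdd R η)⁻¹ *ᵥ x, ?_, ?_⟩
  · rw [mulVec_mulVec, mul_nonsing_inv _ h, one_mulVec]
  · rw [lorentz, smul_mulVec]

/-- Completing the square: with `q = (R² + η²)⁻¹x`, the form of `R² + η²` is nonnegative at `z - q`.
Every test vector `z` thus gives a lower bound, and no diagonalisation of `R` is needed. -/
theorem lorentz_variational {R : Matrix ι ι ℝ} (hR : R.IsSymm) {η : ℝ} (hη : 0 < η)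
    (x z : ι → ℝ) :
    η ^ 2 * (2 * (x ⬝ᵥ z) - z ⬝ᵥ sqAdd R η *ᵥ z) ≤ x ⬝ᵥ lorentz R η *ᵥ x := by
  obtain ⟨q, hq, hl⟩ := exists_lorentz_mulVec hR hη x
  have h1 : 0 ≤ (z - q) ⬝ᵥ sqAdd R η *ᵥ (z - q) := by
    rw [dotProduct_sqAdd_mulVec hR]
    have := dotProduct_self_nonneg_real (R *ᵥ (z - q))
    have := dotProduct_self_nonneg_real (z - q)
    positivity
  rw [mulVec_sub, hq, sub_dotProduct, dotProduct_sub, dotProduct_sub,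
    dotProduct_mulVec_of_isSymm (sqAdd_isSymm hR η) q, hq, dotProduct_comm z x,
    dotProduct_comm q x] at h1
  rw [hl, dotProduct_smul, smul_eq_mul]
  gcongr
  linarith

theorem lorentz_nonneg {R : Matrix ι ι ℝ} (hR : R.IsSymm) {η : ℝ} (hη : 0 < η) (x : ι → ℝ) :
    0 ≤ x ⬝ᵥ lorentz R η *ᵥ x := by
  simpa using lorentz_variational hR hη x 0

/-- Expanding `0 ≤ |R²q|² = |x - η²q|²` and inserting `q·x = |Rq|² + η²|q|²` leaves `|x|² ≥ η² q·x +
η²|Rq|²`. -/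
theorem lorentz_le {R : Matrix ι ι ℝ} (hR : R.IsSymm) {η : ℝ} (hη : 0 < η) (x : ι → ℝ) :
    x ⬝ᵥ lorentz R η *ᵥ x ≤ x ⬝ᵥ x := by
  obtain ⟨q, hq, hl⟩ := exists_lorentz_mulVec hR hη x
  have hRR : R *ᵥ R *ᵥ q = x - η ^ 2 • q := by
    rw [← hq, sqAdd, add_mulVec, mulVec_mulVec, smul_mulVec, one_mulVec, add_sub_cancel_right]
  have h1 : q ⬝ᵥ x = (R *ᵥ q) ⬝ᵥ (R *ᵥ q) + η ^ 2 * (q ⬝ᵥ q) := by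
    rw [← dotProduct_sqAdd_mulVec hR, hq]
  have h2 := dotProduct_self_nonneg_real (R *ᵥ R *ᵥ q)
  have h3 := dotProduct_self_nonneg_real (R *ᵥ q)
  rw [hRR] at h2
  simp only [sub_dotProduct, dotProduct_sub, smul_dotProduct, dotProduct_smul, smul_eq_mul,
    dotProduct_comm x q] at h2
  rw [hl, dotProduct_smul, smul_eq_mul, dotProduct_comm x q]
  have h4 : 0 < η ^ 2 := by positivity
  nlinarith [mul_nonneg h4.le h3]

/-- A subspace on which `|R w| ≤ η |w|` has dimension at most twice the trace. -/
theorem finrank_le_two_mul_trace_lorentz {R : Matrix ι ι ℝ} (hR : R.IsSymm) {η : ℝ} (hη : 0 < η)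
    (W : Submodule ℝ (EuclideanSpace ℝ ι))
    (hW : ∀ w ∈ W, (R *ᵥ w.ofLp) ⬝ᵥ (R *ᵥ w.ofLp) ≤ η ^ 2 * (w.ofLp ⬝ᵥ w.ofLp)) :
    (Module.finrank ℝ W : ℝ) ≤ 2 * (lorentz R η).trace := by
  set n := Module.finrank ℝ W
  let b := stdOrthonormalBasis ℝ W
  let w : Fin n → ι → ℝ := fun i => ((b i : W) : EuclideanSpace ℝ ι).ofLp
  have horth : ∀ i j, w i ⬝ᵥ w j = if i = j then 1 else 0 := by
    intro i j
    have := orthonormal_iff_ite.1 b.orthonormal j i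
    rw [Submodule.coe_inner, EuclideanSpace.inner_eq_star_dotProduct, star_trivial] at this
    rw [show w i ⬝ᵥ w j = _ from this]
    simp [eq_comm]
  have hη2 : 0 < η ^ 2 := by positivity
  -- The test vector for the `k`-th diagonal entry is `t` times the projection of `e_k` onto `W`.
  -- Summed over `k`, the lower bound is `η²(2t - 2η²t²)n`; this `t` maximises it, with value `n/2`.
  set t : ℝ := (2 * η ^ 2)⁻¹ with ht
  let z : ι → ι → ℝ := fun k => t • ∑ i, w i k • w i
  have h1 : ∀ k, η ^ 2 * (2 * z k k - z k ⬝ᵥ sqAdd R η *ᵥ z k) ≤ lorentz R η k k := by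
    intro k
    have := lorentz_variational hR hη (Pi.single k 1) (z k)
    simpa using this
  have h2 : ∑ k, z k k = t * n := by
    have : ∀ k, z k k = t * ∑ i, w i k * w i k := fun k => by simp [z, Finset.sum_apply]
    simp_rw [this]
    rw [← Finset.mul_sum, Finset.sum_comm]
    have : ∀ i, ∑ k, w i k * w i k = 1 := fun i => by
      have := horth i i
      rwa [if_pos rfl] at this
    simp [this]
  have h3 : ∑ k, z k ⬝ᵥ sqAdd R η *ᵥ z k ≤ t ^ 2 * (n * (2 * η ^ 2)) := by
    have e : ∀ k, z k ⬝ᵥ sqAdd R η *ᵥ z k =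
        t ^ 2 * ∑ i, ∑ j, (w i k * w j k) * (w i ⬝ᵥ sqAdd R η *ᵥ w j) := by
      intro k
      simp only [z, mulVec_smul, dotProduct_smul, smul_dotProduct, mulVec_sum, sum_dotProduct,
        dotProduct_sum, smul_eq_mul, Finset.mul_sum]
      refine Finset.sum_comm.trans ?_
      exact Finset.sum_congr rfl fun i _ => Finset.sum_congr rfl fun j _ => by ring
    simp_rw [e]
    rw [← Finset.mul_sum, Finset.sum_comm]
    gcongr
    have e2 : ∀ i, ∑ k, ∑ j, (w i k * w j k) * (w i ⬝ᵥ sqAdd R η *ᵥ w j) =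
        w i ⬝ᵥ sqAdd R η *ᵥ w i := by
      intro i
      rw [Finset.sum_comm]
      have : ∀ j, ∑ k, (w i k * w j k) * (w i ⬝ᵥ sqAdd R η *ᵥ w j) =
          (w i ⬝ᵥ w j) * (w i ⬝ᵥ sqAdd R η *ᵥ w j) := fun j => by
        rw [← Finset.sum_mul]; rfl
      simp [this, horth]
    simp_rw [e2]
    have e3 : ∀ i, w i ⬝ᵥ sqAdd R η *ᵥ w i ≤ 2 * η ^ 2 := by
      intro i
      rw [dotProduct_sqAdd_mulVec hR]
      have h4 := hW _ (b i).2
      have h5 := horth i i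
      rw [if_pos rfl] at h5
      change (R *ᵥ w i) ⬝ᵥ (R *ᵥ w i) ≤ η ^ 2 * (w i ⬝ᵥ w i) at h4
      rw [h5] at h4 ⊢
      linarith
    calc _ ≤ ∑ i : Fin n, 2 * η ^ 2 := Finset.sum_le_sum fun i _ => e3 i
      _ = _ := by simp
  have h4 : η ^ 2 * (2 * (t * n) - t ^ 2 * (n * (2 * η ^ 2))) ≤ (lorentz R η).trace := by
    calc _ ≤ η ^ 2 * (2 * ∑ k, z k k - ∑ k, z k ⬝ᵥ sqAdd R η *ᵥ z k) := by
          rw [h2]; gcongr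
      _ = ∑ k, η ^ 2 * (2 * z k k - z k ⬝ᵥ sqAdd R η *ᵥ z k) := by
          rw [← Finset.mul_sum, Finset.sum_sub_distrib, Finset.mul_sum]
      _ ≤ _ := Finset.sum_le_sum fun k _ => h1 k
  have h5 : η ^ 2 * (2 * (t * n) - t ^ 2 * (n * (2 * η ^ 2))) = n / 2 := by
    rw [ht]; field_simp; ring
  linarith

theorem sum_eq_add_sum_ne (k : ι) (f : ι → ℝ) : ∑ i, f i = f k + ∑ j : {j // j ≠ k}, f j := by
  rw [← Finset.add_sum_erase _ _ (Finset.mem_univ k)]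
  congr 1
  exact Finset.sum_subtype _ (by simp) f

/-- Schur complement bound for a diagonal entry. -/
theorem lorentz_diag_le {R : Matrix ι ι ℝ} (hR : R.IsSymm) {η : ℝ} (hη : 0 < η) (k : ι)
    (a : {j // j ≠ k} → ℝ) (ha : ∀ j, a j = R k j) :
    lorentz R η k k * (η ^ 2 + a ⬝ᵥ lorentz (minor R k) η *ᵥ a) ≤ η ^ 2 := by
  obtain ⟨y, hy, hly⟩ := exists_lorentz_mulVec hR hη (Pi.single k 1)
  obtain ⟨q, hq, hlq⟩ := exists_lorentz_mulVec (minor_isSymm hR k) hη a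
  have hB := minor_isSymm hR k
  set B := minor R k with hBdef
  set y' : {j // j ≠ k} → ℝ := fun j => y j with hy'
  have hkk : lorentz R η k k = η ^ 2 * y k := by
    have := congrFun hly k
    simpa using this
  have hyk : y k = (R *ᵥ y) ⬝ᵥ (R *ᵥ y) + η ^ 2 * (y ⬝ᵥ y) := by
    rw [← dotProduct_sqAdd_mulVec hR, hy]; simp
  have hRy : (B *ᵥ y' + y k • a) ⬝ᵥ (B *ᵥ y' + y k • a) ≤ (R *ᵥ y) ⬝ᵥ (R *ᵥ y) := by
    have e : ∀ j : {j // j ≠ k}, (B *ᵥ y' + y k • a) j = (R *ᵥ y) j := by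
      intro j
      simp only [Pi.add_apply, Pi.smul_apply, mulVec, dotProduct, smul_eq_mul]
      rw [sum_eq_add_sum_ne k, ha, hR.apply k j]
      simp [hBdef, minor, hy']
      ring
    simp only [dotProduct]
    rw [sum_eq_add_sum_ne k (fun i => (R *ᵥ y) i * (R *ᵥ y) i)]
    simp_rw [e]
    linarith [mul_self_nonneg ((R *ᵥ y) k)]
  have hyy : y ⬝ᵥ y = y k ^ 2 + y' ⬝ᵥ y' := by
    simp only [dotProduct]
    rw [sum_eq_add_sum_ne k, sq]
  have haq : a ⬝ᵥ q = (B *ᵥ q) ⬝ᵥ (B *ᵥ q) + η ^ 2 * (q ⬝ᵥ q) := by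
    rw [← dotProduct_sqAdd_mulVec hB, hq, dotProduct_comm]
  set s := y k with hs
  -- The minimum over `y'` of `|By' + sa|² + η²|y'|²` is `s²η² a·q`, attained at `y' = -sBq`, where
  -- `By' + sa = sη²q`. `t1` and `t2` are the squared deviations from this minimiser.
  have t1 := dotProduct_self_nonneg_real (B *ᵥ y' + s • a - (s * η ^ 2) • q)
  have t2 := dotProduct_self_nonneg_real (y' + s • (B *ᵥ q))
  have hsw : y' ⬝ᵥ B *ᵥ q = (B *ᵥ y') ⬝ᵥ q := dotProduct_mulVec_of_isSymm hB _ _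
  have hlow : s ^ 2 * η ^ 2 * (a ⬝ᵥ q) ≤
      (B *ᵥ y' + s • a) ⬝ᵥ (B *ᵥ y' + s • a) + η ^ 2 * (y' ⬝ᵥ y') := by
    set u := B *ᵥ y' + s • a with hu
    have huq : u ⬝ᵥ q = (B *ᵥ y') ⬝ᵥ q + s * (a ⬝ᵥ q) := by
      rw [hu, add_dotProduct, smul_dotProduct, smul_eq_mul]
    simp only [sub_dotProduct, dotProduct_sub, smul_dotProduct, dotProduct_smul, smul_eq_mul,
      dotProduct_comm q u, huq] at t1
    simp only [add_dotProduct, dotProduct_add, smul_dotProduct, dotProduct_smul, smul_eq_mul,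
      dotProduct_comm (B *ᵥ q) y', hsw] at t2
    have t3 := mul_nonneg (sq_nonneg η) t2
    have t4 : s ^ 2 * η ^ 2 * (a ⬝ᵥ q) =
      s ^ 2 * η ^ 2 * ((B *ᵥ q) ⬝ᵥ (B *ᵥ q) + η ^ 2 * (q ⬝ᵥ q)) := by rw [haq]
    linarith
  have hmain : s ^ 2 * (η ^ 2 + η ^ 2 * (a ⬝ᵥ q)) ≤ s := by
    have : η ^ 2 * (y ⬝ᵥ y) = η ^ 2 * (s ^ 2 + y' ⬝ᵥ y') := by rw [hyy]
    linarith
  have hs0 : 0 ≤ s := by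
    rw [hyk]
    have := dotProduct_self_nonneg_real (R *ᵥ y)
    have := dotProduct_self_nonneg_real y
    positivity
  rw [hkk, hlq, dotProduct_smul, smul_eq_mul]
  rcases hs0.eq_or_lt with h0 | h0
  · rw [← h0]; simp [sq_nonneg]
  · have : s * (η ^ 2 + η ^ 2 * (a ⬝ᵥ q)) ≤ 1 := by
      by_contra hcon
      push Not at hcon
      have := mul_lt_mul_of_pos_left hcon h0
      linarith
    have hη2 : 0 ≤ η ^ 2 := by positivity
    calc _ = η ^ 2 * (s * (η ^ 2 + η ^ 2 * (a ⬝ᵥ q))) := by ring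
      _ ≤ η ^ 2 * 1 := by gcongr
      _ = _ := mul_one _

/-- Extension by zero from the complement of `k`. -/
noncomputable def extendZero (k : ι) :
    EuclideanSpace ℝ {j // j ≠ k} →ₗ[ℝ] EuclideanSpace ℝ ι where
  toFun v := WithLp.toLp 2 fun i => if h : i ≠ k then v ⟨i, h⟩ else 0
  map_add' v w := by
    ext i
    by_cases h : i = k <;> simp [h]
  map_smul' c v := by
    ext i
    by_cases h : i = k <;> simp [h]

/-- Rank-nullity for the map into the quotient by `V`: vectors vanishing at `k` form a hyperplane,
so intersecting with it loses at most one dimension. -/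
theorem finrank_le_finrank_comap_extendZero_add_one (k : ι) (V : Submodule ℝ (EuclideanSpace ℝ ι)) :
    Module.finrank ℝ V ≤ Module.finrank ℝ (V.comap (extendZero k)) + 1 := by
  have h1 := LinearMap.finrank_range_add_finrank_ker (V.mkQ ∘ₗ extendZero k)
  rw [LinearMap.ker_comp, Submodule.ker_mkQ] at h1
  have h2 := Submodule.finrank_le (LinearMap.range (V.mkQ ∘ₗ extendZero k))
  have h3 := V.finrank_quotient_add_finrank
  rw [finrank_euclideanSpace] at h1 h3
  have h4 : Fintype.card ι = Fintype.card {j // j ≠ k} + 1 := by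
    have := Fintype.card_pos_iff.2 ⟨k⟩
    rw [Fintype.card_subtype_compl, Fintype.card_subtype_eq]
    omega
  omega

/-- A substitute for eigenvalue interlacing: on vectors of `V` vanishing at `k`, the minor acts as
`R` with the `k`-th output coordinate deleted, which only shortens the image. -/
theorem finrank_sub_one_le_two_mul_trace_lorentz_minor {R : Matrix ι ι ℝ} (hR : R.IsSymm) {η : ℝ}
    (hη : 0 < η) (k : ι) (V : Submodule ℝ (EuclideanSpace ℝ ι))
    (hV : ∀ w ∈ V, (R *ᵥ w.ofLp) ⬝ᵥ (R *ᵥ w.ofLp) ≤ η ^ 2 * (w.ofLp ⬝ᵥ w.ofLp)) :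
    (Module.finrank ℝ V : ℝ) - 1 ≤ 2 * (lorentz (minor R k) η).trace := by
  have h1 := finrank_le_two_mul_trace_lorentz (minor_isSymm hR k) hη (V.comap (extendZero k)) (by
    intro w hw
    have h := hV _ hw
    set v := (extendZero k w).ofLp with hv
    have hvk : v k = 0 := by simp [hv, extendZero]
    have hvj : ∀ j : {j // j ≠ k}, v j = w j := fun j => by
      have := j.2
      simp [hv, extendZero, this]
    have e1 : v ⬝ᵥ v = w.ofLp ⬝ᵥ w.ofLp := by
      simp only [dotProduct]
      rw [sum_eq_add_sum_ne k, hvk]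
      simp [hvj]
    have e2 : ∀ j : {j // j ≠ k}, (minor R k *ᵥ w.ofLp) j = (R *ᵥ v) j := by
      intro j
      simp only [mulVec, dotProduct]
      rw [sum_eq_add_sum_ne k, hvk]
      simp [hvj, minor]
    rw [e1] at h
    refine le_trans ?_ h
    simp only [dotProduct]
    rw [sum_eq_add_sum_ne k (fun i => (R *ᵥ v) i * (R *ᵥ v) i)]
    simp_rw [e2]
    linarith [mul_self_nonneg ((R *ᵥ v) k)])
  have h2 := finrank_le_finrank_comap_extendZero_add_one k V
  have h3 : (Module.finrank ℝ V : ℝ) ≤ Module.finrank ℝ (V.comap (extendZero k)) + 1 := by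
    exact_mod_cast h2
  linarith

/-- The span of the eigenvectors with eigenvalue within `η` of `E`. -/
theorem exists_submodule_of_eigenvalues {H : Matrix ι ι ℝ} (hH : H.IsHermitian) {E η : ℝ}
    (S : Finset ι) (hS : ∀ i ∈ S, |hH.eigenvalues i - E| ≤ η) :
    ∃ V : Submodule ℝ (EuclideanSpace ℝ ι), Module.finrank ℝ V = S.card ∧
      ∀ w ∈ V, ((H - E • (1 : Matrix ι ι ℝ)) *ᵥ w.ofLp) ⬝ᵥ ((H - E • (1 : Matrix ι ι ℝ)) *ᵥ w.ofLp)
        ≤ η ^ 2 * (w.ofLp ⬝ᵥ w.ofLp) := by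
  set v : S → EuclideanSpace ℝ ι := fun i => hH.eigenvectorBasis i with hv
  have hon : Orthonormal ℝ v := hH.eigenvectorBasis.orthonormal.comp _ Subtype.val_injective
  refine ⟨Submodule.span ℝ (Set.range v), ?_, ?_⟩
  · rw [finrank_span_eq_card hon.linearIndependent]; simp
  · intro w hw
    obtain ⟨c, rfl⟩ := (Submodule.mem_span_range_iff_exists_fun ℝ).1 hw
    have horth : ∀ i j : S, (v i).ofLp ⬝ᵥ (v j).ofLp = if i = j then 1 else 0 := by
      intro i j
      have := orthonormal_iff_ite.1 hon j i
      rw [EuclideanSpace.inner_eq_star_dotProduct, star_trivial] at this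
      rw [this]
      simp [eq_comm]
    have hsq : ∀ d : S → ℝ, (∑ i, d i • (v i).ofLp) ⬝ᵥ (∑ i, d i • (v i).ofLp) =
        ∑ i, d i ^ 2 := by
      intro d
      simp [sum_dotProduct, dotProduct_sum, horth, sq]
    have hev : ∀ i : S, (H - E • (1 : Matrix ι ι ℝ)) *ᵥ (v i).ofLp =
        (hH.eigenvalues i - E) • (v i).ofLp := by
      intro i
      have := hH.mulVec_eigenvectorBasis i
      rw [sub_mulVec, smul_mulVec, one_mulVec, sub_smul]
      congr 1
    have e1 : (∑ i, c i • v i).ofLp = ∑ i, c i • (v i).ofLp := by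
      simp
    have e2 : (H - E • (1 : Matrix ι ι ℝ)) *ᵥ (∑ i, c i • (v i).ofLp) =
        ∑ i, (c i * (hH.eigenvalues i - E)) • (v i).ofLp := by
      rw [mulVec_sum]
      refine Finset.sum_congr rfl fun i _ => ?_
      rw [mulVec_smul, hev, smul_smul]
    rw [e1, e2, hsq, hsq, Finset.mul_sum]
    refine Finset.sum_le_sum fun i _ => ?_
    have h1 := hS i i.2
    have h2 : (hH.eigenvalues i - E) ^ 2 ≤ η ^ 2 := by
      rw [← sq_abs]; gcongr
    rw [mul_pow, mul_comm]
    gcongr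

theorem card_sub_one_le_two_mul_trace_lorentz_minor {H : Matrix ι ι ℝ} (hH : H.IsHermitian)
    {E η : ℝ} (hη : 0 < η) (S : Finset ι) (hS : ∀ i ∈ S, |hH.eigenvalues i - E| ≤ η) (k : ι) :
    (S.card : ℝ) - 1 ≤ 2 * (lorentz (minor (H - E • (1 : Matrix ι ι ℝ)) k) η).trace := by
  obtain ⟨V, hVn, hV⟩ := exists_submodule_of_eigenvalues hH S hS
  rw [← hVn]
  exact finrank_sub_one_le_two_mul_trace_lorentz_minor (hH.isSymm_sub_smul_one E) hη k V hV

/-- If all column quadratic forms are large then there are few eigenvalues in the window. -/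
theorem card_mul_le_of_quadraticForm_ge {H : Matrix ι ι ℝ} (hH : H.IsHermitian) {E η : ℝ}
    (hη : 0 < η) (S : Finset ι) (hS : ∀ i ∈ S, |hH.eigenvalues i - E| ≤ η) {r : ℝ}
    (hr : 0 ≤ r)
    (hquad : ∀ k, r * (lorentz (minor (H - E • (1 : Matrix ι ι ℝ)) k) η).trace ≤
      (fun j : {j // j ≠ k} => H k j) ⬝ᵥ
        lorentz (minor (H - E • (1 : Matrix ι ι ℝ)) k) η *ᵥ fun j => H k j) :
    r * (S.card * ((S.card : ℝ) - 1)) ≤ 4 * Fintype.card ι * η ^ 2 := by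
  have hR := hH.isSymm_sub_smul_one E
  obtain ⟨V, hVn, hV⟩ := exists_submodule_of_eigenvalues hH S hS
  have hn := finrank_le_two_mul_trace_lorentz hR hη V hV
  have hη2 : 0 < η ^ 2 := by positivity
  -- The empty case is separate because the products below need `n - 1 ≥ 0`.
  rcases Nat.eq_zero_or_pos S.card with h0 | h0
  · rw [h0]; simp; positivity
  have h1 : (1 : ℝ) ≤ S.card := by exact_mod_cast h0
  have hdiag : ∀ k, lorentz (H - E • (1 : Matrix ι ι ℝ)) η k k * (r * ((S.card : ℝ) - 1) / 2) ≤
      η ^ 2 := by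
    intro k
    have t1 := lorentz_diag_le hR hη k (fun j => H k j) (fun j => by
      simp [j.2.symm])
    have t2 := card_sub_one_le_two_mul_trace_lorentz_minor hH hη S hS k
    have t3 := hquad k
    have t4 : 0 ≤ lorentz (H - E • (1 : Matrix ι ι ℝ)) η k k := by
      simpa using lorentz_nonneg hR hη (Pi.single k 1)
    refine le_trans ?_ t1
    gcongr
    have t5 : r * ((S.card : ℝ) - 1) ≤
      r * (2 * (lorentz (minor (H - E • (1 : Matrix ι ι ℝ)) k) η).trace) := by gcongr
    linarith
  -- The count enters twice, through the minors as `(n - 1)/2` and through the full trace as `n/2`;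
  -- this makes the final bound quadratic in `n`.
  have hsum : (lorentz (H - E • (1 : Matrix ι ι ℝ)) η).trace * (r * ((S.card : ℝ) - 1) / 2) ≤
      Fintype.card ι * η ^ 2 := by
    rw [trace, Finset.sum_mul]
    calc _ ≤ ∑ _k : ι, η ^ 2 := Finset.sum_le_sum fun k _ => hdiag k
      _ = _ := by simp
  rw [hVn] at hn
  have h2 : 0 ≤ r * ((S.card : ℝ) - 1) := mul_nonneg hr (by linarith)
  nlinarith

/-! ### Measurability, and small quadratic forms of a random column -/

theorem measurable_matrix_det {α ι : Type*} [MeasurableSpace α] [Fintype ι] [DecidableEq ι]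
    {M : α → Matrix ι ι ℝ} (hM : ∀ i j, Measurable fun a => M a i j) :
    Measurable fun a => (M a).det := by
  simp only [det_apply]
  refine Finset.measurable_sum _ fun σ _ => ?_
  exact (Finset.measurable_prod _ fun i _ => hM _ _).const_smul _

theorem measurable_matrix_inv_apply {α ι : Type*} [MeasurableSpace α] [Fintype ι] [DecidableEq ι]
    {M : α → Matrix ι ι ℝ} (hM : ∀ i j, Measurable fun a => M a i j) (i j : ι) :
    Measurable fun a => (M a)⁻¹ i j := by
  simp only [inv_def, Matrix.smul_apply, smul_eq_mul, adjugate_apply, Ring.inverse_eq_inv']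
  refine (measurable_matrix_det hM).inv.mul (measurable_matrix_det fun p q => ?_)
  simp only [updateRow_apply]
  split_ifs
  · exact measurable_const
  · exact hM p q

theorem measurable_lorentz_apply {α ι : Type*} [MeasurableSpace α] [Fintype ι] [DecidableEq ι]
    {R : α → Matrix ι ι ℝ} (hR : ∀ i j, Measurable fun a => R a i j) (η : ℝ) (i j : ι) :
    Measurable fun a => lorentz (R a) η i j := by
  simp only [lorentz, Matrix.smul_apply, smul_eq_mul]
  refine (measurable_matrix_inv_apply (fun p q => ?_) i j).const_mul _
  simp only [sqAdd, Matrix.add_apply, Matrix.mul_apply]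
  exact (Finset.measurable_sum _ fun l _ => (hR p l).mul (hR l q)).add_const _

theorem lintegral_exp_neg_quadraticForm_le_of_fintype {κ : Type*} [Fintype κ]
    {ν : Measure ℝ} [IsProbabilityMeasure ν] {C l : ℝ}
    (hl : 0 ≤ l) (hl1 : l ≤ 1) (hCl : 10 * C * l ≤ 1) (hC : 0 ≤ C)
    (hlap : ∀ α β : ℝ, 0 ≤ α → α ≤ 1 →
      ∫⁻ b, ENNReal.ofReal (Real.exp (-α * b ^ 2 + β * b)) ∂ν ≤
        ENNReal.ofReal (Real.exp (-α + C * (α ^ 2 + β ^ 2))))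
    (A : Matrix κ κ ℝ) (hA : A.IsSymm) (h0 : ∀ x, 0 ≤ x ⬝ᵥ A *ᵥ x)
    (h1 : ∀ x, x ⬝ᵥ A *ᵥ x ≤ x ⬝ᵥ x) :
    ∫⁻ b, ENNReal.ofReal (Real.exp (-(l * (b ⬝ᵥ A *ᵥ b)))) ∂(Measure.pi fun _ : κ => ν) ≤
      ENNReal.ofReal (Real.exp (-(l / 2 * A.trace))) := by
  let e : Fin (Fintype.card κ) ≃ κ := (Fintype.equivFin κ).symm
  have hq : ∀ x : Fin (Fintype.card κ) → ℝ, (x ∘ e.symm) ⬝ᵥ A *ᵥ (x ∘ e.symm) =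
      x ⬝ᵥ A.submatrix e e *ᵥ x := by
    intro x
    simp only [dotProduct, mulVec, ← e.sum_comp, Function.comp_apply, Equiv.symm_apply_apply,
      submatrix_apply]
  have hn : ∀ x : Fin (Fintype.card κ) → ℝ, (x ∘ e.symm) ⬝ᵥ (x ∘ e.symm) = x ⬝ᵥ x := by
    intro x
    simp only [dotProduct, ← e.sum_comp, Function.comp_apply, Equiv.symm_apply_apply]
  have ht : (A.submatrix e e).trace = A.trace := by
    simp only [trace, diag_apply, ← e.sum_comp (fun i => A i i), submatrix_apply]
  have h := lintegral_exp_neg_quadraticForm_le hl hl1 hCl hC hlap _ (A.submatrix e e)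
    (hA.submatrix _) (fun x => hq x ▸ h0 _) (fun x => hq x ▸ hn x ▸ h1 _)
  have mp := measurePreserving_piCongrLeft (fun _ : κ => ν) e
  rw [ht] at h
  rw [← mp.lintegral_comp (by simp only [dotProduct, mulVec]; fun_prop)]
  refine le_trans (le_of_eq (lintegral_congr fun b => ?_)) h
  have hb : (MeasurableEquiv.piCongrLeft (fun _ : κ => ℝ) e) b = b ∘ e.symm := by
    funext j
    obtain ⟨i, rfl⟩ := e.surjective j
    rw [MeasurableEquiv.coe_piCongrLeft, Equiv.piCongrLeft_apply_apply]
    simp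
  rw [hb, hq]

/-- Chernoff's bound: the threshold contributes `exp(l t/4)` against the Laplace transform `exp(-l
t/2)`. -/
theorem measure_quadraticForm_le_quarter_trace {κ : Type*} [Fintype κ]
    {ν : Measure ℝ} [IsProbabilityMeasure ν] {C l : ℝ}
    (hl : 0 ≤ l) (hl1 : l ≤ 1) (hCl : 10 * C * l ≤ 1) (hC : 0 ≤ C)
    (hlap : ∀ α β : ℝ, 0 ≤ α → α ≤ 1 →
      ∫⁻ b, ENNReal.ofReal (Real.exp (-α * b ^ 2 + β * b)) ∂ν ≤
        ENNReal.ofReal (Real.exp (-α + C * (α ^ 2 + β ^ 2))))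
    (A : Matrix κ κ ℝ) (hA : A.IsSymm) (h0 : ∀ x, 0 ≤ x ⬝ᵥ A *ᵥ x)
    (h1 : ∀ x, x ⬝ᵥ A *ᵥ x ≤ x ⬝ᵥ x) :
    Measure.pi (fun _ : κ => ν) {b | b ⬝ᵥ A *ᵥ b ≤ A.trace / 4} ≤
      ENNReal.ofReal (Real.exp (-(l / 4 * A.trace))) := by
  have hint := lintegral_exp_neg_quadraticForm_le_of_fintype hl hl1 hCl hC hlap A hA h0 h1
  set t := A.trace
  have hmk := mul_meas_ge_le_lintegral₀ (μ := Measure.pi fun _ : κ => ν)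
    (f := fun b => ENNReal.ofReal (Real.exp (-(l * (b ⬝ᵥ A *ᵥ b)))))
    (by simp only [dotProduct, mulVec]; fun_prop) (ENNReal.ofReal (Real.exp (-(l * (t / 4)))))
  calc _ ≤ Measure.pi (fun _ : κ => ν) {b | ENNReal.ofReal (Real.exp (-(l * (t / 4)))) ≤
        ENNReal.ofReal (Real.exp (-(l * (b ⬝ᵥ A *ᵥ b))))} := by
        refine measure_mono fun b (hb : b ⬝ᵥ A *ᵥ b ≤ t / 4) => ?_
        refine ENNReal.ofReal_le_ofReal (Real.exp_le_exp.2 (neg_le_neg ?_))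
        gcongr
    _ = ENNReal.ofReal (Real.exp (l * (t / 4))) * (ENNReal.ofReal (Real.exp (-(l * (t / 4)))) *
        Measure.pi (fun _ : κ => ν) {b | ENNReal.ofReal (Real.exp (-(l * (t / 4)))) ≤
        ENNReal.ofReal (Real.exp (-(l * (b ⬝ᵥ A *ᵥ b))))}) := by
        rw [← mul_assoc, ← ENNReal.ofReal_mul (Real.exp_pos _).le, ← Real.exp_add]
        simp
    _ ≤ ENNReal.ofReal (Real.exp (l * (t / 4))) *
        ENNReal.ofReal (Real.exp (-(l / 2 * t))) := by
        gcongr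
        exact hmk.trans hint
    _ = _ := by
        rw [← ENNReal.ofReal_mul (Real.exp_pos _).le, ← Real.exp_add]
        congr 2; ring

/-- The matrix with entries `c y_{ij} - E δ_{ij}`. -/
noncomputable def shiftedMatrix {κ : Type*} [DecidableEq κ] (c E : ℝ) (y : Sym2 κ → ℝ) :
    Matrix κ κ ℝ :=
  Matrix.of (fun i j => c * y s(i, j)) - E • (1 : Matrix κ κ ℝ)

theorem shiftedMatrix_isSymm {κ : Type*} [DecidableEq κ] (c E : ℝ) (y : Sym2 κ → ℝ) :
    (shiftedMatrix c E y).IsSymm := by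
  refine IsSymm.sub ?_ (isSymm_one.smul _)
  ext i j
  simp [Sym2.eq_swap]

theorem minor_wignerMatrix_sub {N : ℕ} (x : Sym2 (Fin N) → ℝ) (E : ℝ) (k : Fin N) :
    minor (wignerMatrix x - E • (1 : Matrix (Fin N) (Fin N) ℝ)) k =
      shiftedMatrix (√(N : ℝ))⁻¹ E (fun e : Sym2 {j // j ≠ k} => x (e.map Subtype.val)) := by
  ext i j
  simp [minor, shiftedMatrix, wignerMatrix, Matrix.one_apply, Subtype.ext_iff]

/-- Conditionally on the minor, the matrix of the form is fixed and the column is still a vector of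
independent variables with law `ν`. Requiring the trace to be at least `τ` makes the conditional
bound uniform, and Fubini concludes. -/
theorem measure_column_quadraticForm_le {N : ℕ} {Ω : Type*} [MeasurableSpace Ω] {P : Measure Ω}
    [IsProbabilityMeasure P] {ν νd : Measure ℝ} [IsProbabilityMeasure ν]
    {x : Sym2 (Fin N) → Ω → ℝ} (hx : IsWignerFamily P ν νd N x) {C l : ℝ}
    (hl : 0 ≤ l) (hl1 : l ≤ 1) (hCl : 10 * C * l ≤ 1) (hC : 0 ≤ C)
    (hlap : ∀ α β : ℝ, 0 ≤ α → α ≤ 1 →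
      ∫⁻ b, ENNReal.ofReal (Real.exp (-α * b ^ 2 + β * b)) ∂ν ≤
        ENNReal.ofReal (Real.exp (-α + C * (α ^ 2 + β ^ 2))))
    {E η τ c : ℝ} (hη : 0 < η) (k : Fin N) :
    P {ω | τ ≤ (lorentz (shiftedMatrix c E
          (fun e : Sym2 {j // j ≠ k} => x (e.map Subtype.val) ω)) η).trace ∧
        (fun j : {j // j ≠ k} => x s(k, j) ω) ⬝ᵥ (lorentz (shiftedMatrix c E
          (fun e : Sym2 {j // j ≠ k} => x (e.map Subtype.val) ω)) η) *ᵥ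
          (fun j : {j // j ≠ k} => x s(k, j) ω) ≤
        (lorentz (shiftedMatrix c E
          (fun e : Sym2 {j // j ≠ k} => x (e.map Subtype.val) ω)) η).trace / 4} ≤
      ENNReal.ofReal (Real.exp (-(l / 4 * τ))) := by
  have hm : ∀ e, AEMeasurable (x e) P := by
    intro e
    induction e with
    | _ i j =>
      by_cases h : i = j
      · subst h; exact (hx.law_diag i).aemeasurable
      · exact (hx.law_offDiag i j h).aemeasurable
  set b : Ω → {j // j ≠ k} → ℝ := fun ω j => x s(k, j) ω with hb
  set Y : Ω → Sym2 {j // j ≠ k} → ℝ := fun ω e => x (e.map Subtype.val) ω with hY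
  have hbm : AEMeasurable b P := aemeasurable_pi_lambda _ fun j => hm _
  have hYm : AEMeasurable Y P := aemeasurable_pi_lambda _ fun e => hm _
  have hblaw : P.map b = Measure.pi fun _ => ν := by
    have hinj : Function.Injective fun j : {j // j ≠ k} => s(k, (j : Fin N)) := by
      intro i j hij
      exact Subtype.ext (Sym2.congr_right.1 hij)
    have h1 := (iIndepFun_iff_map_fun_eq_pi_map (fun j : {j // j ≠ k} => hm s(k, (j : Fin N)))).1
      (hx.indep.precomp hinj)
    rw [hb, h1]
    congr 1
    funext j
    exact (hx.law_offDiag k j j.2.symm).map_eq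
  have hind : IndepFun Y b P := by
    classical
    let S : Finset (Sym2 (Fin N)) :=
      Finset.univ.image fun e : Sym2 {j // j ≠ k} => e.map Subtype.val
    let T : Finset (Sym2 (Fin N)) := Finset.univ.image fun j : {j // j ≠ k} => s(k, (j : Fin N))
    -- Pairs indexing the minor avoid `k`, while pairs indexing the column contain it.
    have hST : Disjoint S T := by
      rw [Finset.disjoint_left]
      intro e he he'
      obtain ⟨f, -, rfl⟩ := Finset.mem_image.1 he
      obtain ⟨j, -, hj⟩ := Finset.mem_image.1 he'
      have hk : k ∈ f.map Subtype.val := by rw [← hj]; exact Sym2.mem_mk_left _ _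
      obtain ⟨i, -, hi⟩ := Sym2.mem_map.1 hk
      exact i.2 hi
    have h1 := hx.indep.indepFun_finset₀ S T hST hm
    exact h1.comp
      (φ := fun v (e : Sym2 {j // j ≠ k}) => v ⟨e.map Subtype.val,
        Finset.mem_image_of_mem _ (Finset.mem_univ e)⟩)
      (ψ := fun v (j : {j // j ≠ k}) => v ⟨s(k, (j : Fin N)),
        Finset.mem_image_of_mem _ (Finset.mem_univ j)⟩)
      (measurable_pi_lambda _ fun e => measurable_pi_apply _)
      (measurable_pi_lambda _ fun j => measurable_pi_apply _)
  have hjoint := (indepFun_iff_map_prod_eq_prod_map_map hYm hbm).1 hind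
  rw [hblaw] at hjoint
  have hAm : ∀ i j, Measurable fun y : Sym2 {j // j ≠ k} → ℝ =>
      lorentz (shiftedMatrix c E y) η i j := by
    refine measurable_lorentz_apply (fun i j => ?_) η
    simp only [shiftedMatrix, Matrix.sub_apply, of_apply]
    exact ((measurable_pi_apply _).const_mul _).sub_const _
  have htr : Measurable fun y : Sym2 {j // j ≠ k} → ℝ => (lorentz (shiftedMatrix c E y) η).trace :=
    Finset.measurable_sum _ fun i _ => hAm i i
  let Q : Set ((Sym2 {j // j ≠ k} → ℝ) × ({j // j ≠ k} → ℝ)) :=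
    {p | τ ≤ (lorentz (shiftedMatrix c E p.1) η).trace ∧
      p.2 ⬝ᵥ lorentz (shiftedMatrix c E p.1) η *ᵥ p.2 ≤
        (lorentz (shiftedMatrix c E p.1) η).trace / 4}
  have hQ : MeasurableSet Q := by
    refine (measurableSet_le measurable_const (htr.comp measurable_fst)).inter
      (measurableSet_le ?_ ((htr.comp measurable_fst).div_const _))
    simp only [dotProduct, mulVec]
    refine Finset.measurable_sum _ fun i _ => Measurable.mul (by fun_prop)
      (Finset.measurable_sum _ fun j _ => Measurable.mul ?_ (by fun_prop))
    exact (hAm i j).comp measurable_fst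
  have hYb : IsProbabilityMeasure (P.map Y) := Measure.isProbabilityMeasure_map hYm
  calc _ = P.map (fun ω => (Y ω, b ω)) Q :=
        (Measure.map_apply_of_aemeasurable (hYm.prodMk hbm) hQ).symm
    _ = ∫⁻ y, Measure.pi (fun _ => ν) (Prod.mk y ⁻¹' Q) ∂(P.map Y) := by
        rw [hjoint, Measure.prod_apply hQ]
    _ ≤ ∫⁻ _y, ENNReal.ofReal (Real.exp (-(l / 4 * τ))) ∂(P.map Y) := by
        refine lintegral_mono fun y => ?_
        by_cases hy : τ ≤ (lorentz (shiftedMatrix c E y) η).trace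
        · have hs := shiftedMatrix_isSymm c E y
          refine (measure_mono fun v (hv : _ ∧ _) => hv.2).trans
            ((measure_quadraticForm_le_quarter_trace hl hl1 hCl hC hlap _ (lorentz_isSymm hs η)
              (lorentz_nonneg hs hη) (lorentz_le hs hη)).trans ?_)
          refine ENNReal.ofReal_le_ofReal (Real.exp_le_exp.2 (neg_le_neg ?_))
          gcongr
        · have : Prod.mk y ⁻¹' Q = ∅ := Set.eq_empty_of_forall_notMem fun v hv => hy hv.1
          rw [this, measure_empty]
          exact zero_le
    _ = _ := by simp

/-! ### From many eigenvalues to a bad column, and the union bound -/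

theorem exists_center_of_ordConnected {I : Set ℝ} (hI : I.OrdConnected)
    (hb : Bornology.IsBounded I) : ∃ E : ℝ, ∀ y ∈ I, |y - E| ≤ volume.real I / 2 := by
  rcases I.eq_empty_or_nonempty with rfl | hne
  · exact ⟨0, by simp⟩
  have hlen : sSup I - sInf I ≤ volume.real I := by
    rcases le_total (sSup I) (sInf I) with h | h
    · exact (sub_nonpos.2 h).trans measureReal_nonneg
    · rw [← Real.volume_real_Ioo_of_le h]
      exact measureReal_mono
        (IsConnected.Ioo_csInf_csSup_subset ⟨hne, hI.isPreconnected⟩ hb.bddBelow hb.bddAbove)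
        hb.measure_lt_top.ne
  refine ⟨(sInf I + sSup I) / 2, fun y hy => ?_⟩
  have h1 := csInf_le hb.bddBelow hy
  have h2 := le_csSup hb.bddAbove hy
  rw [abs_le]
  constructor <;> linarith

/-- The deterministic half of the argument: if no column is bad, the quadratic bound on the count
contradicts its size. -/
theorem exists_column_quadraticForm_le {N : ℕ} (x : Sym2 (Fin N) → ℝ) {I : Set ℝ} {E m K : ℝ}
    (hE : ∀ y ∈ I, |y - E| ≤ volume.real I / 2) (hI : 0 < volume.real I) (hK : 4 ≤ K)
    (hm : m = K * N * volume.real I) (hm2 : 2 < m) (hcount : m ≤ eigenvalueCount x I) :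
    ∃ k : Fin N, (m - 1) / 2 ≤ (lorentz (shiftedMatrix (√(N : ℝ))⁻¹ E
          (fun e : Sym2 {j // j ≠ k} => x (e.map Subtype.val))) (volume.real I / 2)).trace ∧
        (fun j : {j // j ≠ k} => x s(k, j)) ⬝ᵥ (lorentz (shiftedMatrix (√(N : ℝ))⁻¹ E
          (fun e : Sym2 {j // j ≠ k} => x (e.map Subtype.val))) (volume.real I / 2)) *ᵥ
          (fun j : {j // j ≠ k} => x s(k, j)) ≤
        (lorentz (shiftedMatrix (√(N : ℝ))⁻¹ E
          (fun e : Sym2 {j // j ≠ k} => x (e.map Subtype.val))) (volume.real I / 2)).trace / 4 := by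
  classical
  have hH := wignerMatrix_isHermitian x
  have hη : 0 < volume.real I / 2 := by positivity
  set S : Finset (Fin N) := {k : Fin N | hH.eigenvalues k ∈ I}.toFinset with hSdef
  have hS : ∀ i ∈ S, |hH.eigenvalues i - E| ≤ volume.real I / 2 := fun i hi =>
    hE _ (by simpa [hSdef] using hi)
  have hcard : eigenvalueCount x I = S.card := by
    rw [eigenvalueCount, hSdef, Set.ncard_eq_toFinset_card']
  rw [hcard] at hcount
  have hN : 0 < (N : ℝ) := by
    rcases Nat.eq_zero_or_pos N with h | h
    · rw [hm, h] at hm2; norm_num at hm2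
    · exact_mod_cast h
  by_contra hcon
  push Not at hcon
  -- In `r = 1/(4N)`, the `1/N` comes from the normalisation of the columns of `H` and the `1/4`
  -- from the threshold on the quadratic form.
  have h1 := card_mul_le_of_quadraticForm_ge hH hη S hS (r := 1 / (4 * N)) (by positivity) (by
    intro k
    have t1 := card_sub_one_le_two_mul_trace_lorentz_minor hH hη S hS k
    rw [minor_wignerMatrix_sub] at t1 ⊢
    have t2 := hcon k (by linarith)
    have t3 : (fun j : {j // j ≠ k} => wignerMatrix x k j) =
        (√(N : ℝ))⁻¹ • fun j : {j // j ≠ k} => x s(k, j) := by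
      funext j; simp [wignerMatrix]
    have t4 : (√(N : ℝ))⁻¹ * (√(N : ℝ))⁻¹ = (N : ℝ)⁻¹ := by
      rw [← mul_inv, Real.mul_self_sqrt hN.le]
    rw [t3, mulVec_smul, dotProduct_smul, smul_dotProduct, smul_eq_mul, smul_eq_mul, ← mul_assoc,
      t4, show 1 / (4 * (N : ℝ)) = (N : ℝ)⁻¹ * (1 / 4) by field_simp, mul_assoc]
    gcongr
    linarith)
  rw [Fintype.card_fin] at h1
  have h2 : (S.card : ℝ) * (S.card - 1) ≤ 4 * (N * volume.real I) ^ 2 := by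
    have : (S.card : ℝ) * (S.card - 1) = 4 * N * (1 / (4 * N) * (S.card * (S.card - 1))) := by
      field_simp
    rw [this]
    calc _ ≤ 4 * N * (4 * N * (volume.real I / 2) ^ 2) := by gcongr
      _ = _ := by ring
  -- Since `n ≥ m > 2`, `n(n - 1) > m²/2`; with `m ≥ 4N|I|` this exceeds `8(N|I|)²`, against the
  -- upper bound `4(N|I|)²`.
  have h3 : m ^ 2 / 2 < (S.card : ℝ) * (S.card - 1) := by nlinarith
  have h4 : 4 * (N * volume.real I) ≤ m := by
    rw [hm, mul_assoc]
    gcongr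
  have h5 : 0 < N * volume.real I := by positivity
  nlinarith

theorem eigenvalueCount_tail_of_subgaussianBound {M : ℝ} (hM : 1 ≤ M) :
    ∃ C c K₀ : ℝ, 0 < C ∧ 0 < c ∧ 0 < K₀ ∧
      ∀ (ν νd : Measure ℝ) [IsProbabilityMeasure ν],
        IsCenteredWithVariance ν 1 → SubgaussianBound ν M →
        ∀ (N : ℕ), 1 ≤ N →
        ∀ (Ω : Type*) [MeasurableSpace Ω] (P : Measure Ω) [IsProbabilityMeasure P]
          (x : Sym2 (Fin N) → Ω → ℝ), IsWignerFamily P ν νd N x →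
        ∀ I : Set ℝ, I.OrdConnected → Bornology.IsBounded I →
          (Real.log N) ^ 2 / N ≤ volume.real I →
        ∀ K : ℝ, K₀ ≤ K →
          P.real {ω | K * N * volume.real I ≤ (eigenvalueCount (fun e => x e ω) I : ℝ)} ≤
            C * Real.exp (-(c * √(K * N * volume.real I))) := by
  set L := laplaceConst M
  have hL : 1 ≤ L := one_le_laplaceConst hM
  set l : ℝ := 1 / (10 * L) with hl
  have hl0 : 0 < l := by positivity
  have hl1 : l ≤ 1 := by rw [hl, div_le_one (by positivity)]; linarith
  have hCl : 10 * L * l ≤ 1 := by rw [hl]; field_simp; rfl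
  -- `K₀ = (64/l)²` makes `log N ≤ (l/64)√m`. The factor `e` covers the trivial range `m ≤ 2` and
  -- the loss `l/8` from replacing `m - 1` by `m`.
  refine ⟨Real.exp 1, l / 32, (64 / l) ^ 2, Real.exp_pos _, by positivity, by positivity, ?_⟩
  intro ν νd _ hν hsub N hN Ω _ P _ x hx I hI hIb hlogN K hK
  have hN0 : (0 : ℝ) < N := by exact_mod_cast hN
  have h64 : 64 ≤ 64 / l := by rw [le_div_iff₀ hl0]; nlinarith
  have hK4 : 4 ≤ K := by nlinarith
  set m := K * N * volume.real I with hm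
  have hm0 : 0 ≤ m := by have := measureReal_nonneg (μ := volume) (s := I); positivity
  rcases le_or_gt m 2 with hm2 | hm2
  · have h1 : l / 32 * √m ≤ 1 := by
      have h2 : √m ≤ 2 := by
        rw [Real.sqrt_le_left (by norm_num)]; linarith
      nlinarith [Real.sqrt_nonneg m]
    calc _ ≤ 1 := measureReal_le_one
      _ ≤ Real.exp (1 + -(l / 32 * √m)) := Real.one_le_exp (by linarith)
      _ = _ := Real.exp_add _ _
  have hIpos : 0 < volume.real I := by
    refine lt_of_le_of_ne measureReal_nonneg fun h => ?_
    rw [hm, ← h] at hm2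
    norm_num at hm2
  obtain ⟨E, hE⟩ := exists_center_of_ordConnected hI hIb
  have hlap : ∀ α β : ℝ, 0 ≤ α → α ≤ 1 →
      ∫⁻ b, ENNReal.ofReal (Real.exp (-α * b ^ 2 + β * b)) ∂ν ≤
        ENNReal.ofReal (Real.exp (-α + L * (α ^ 2 + β ^ 2))) := fun α β h0 h1 =>
    integral_exp_neg_sq_add_le hM hν hsub h0 h1
  have hη : 0 < volume.real I / 2 := by positivity
  have hbad := fun k => measure_column_quadraticForm_le hx hl0.le hl1 hCl (by linarith) hlap
    (E := E) (τ := (m - 1) / 2) (c := (√(N : ℝ))⁻¹) hη k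
  have hunion : P {ω | m ≤ (eigenvalueCount (fun e => x e ω) I : ℝ)} ≤
      ENNReal.ofReal (N * Real.exp (-(l / 4 * ((m - 1) / 2)))) := by
    refine (measure_mono fun ω (hω : m ≤ _) => Set.mem_iUnion.2
      (exists_column_quadraticForm_le _ hE hIpos hK4 hm hm2 hω)).trans
      ((measure_iUnion_fintype_le P _).trans ((Finset.sum_le_sum fun k _ => hbad k).trans_eq ?_))
    rw [Finset.sum_const, Finset.card_univ, Fintype.card_fin, nsmul_eq_mul,
      ENNReal.ofReal_mul hN0.le, ENNReal.ofReal_natCast]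
  have hsm : √m * √m = m := Real.mul_self_sqrt hm0
  have hsm1 : 1 ≤ √m := Real.one_le_sqrt.2 (by linarith)
  have hlog : Real.log N ≤ l / 64 * √m := by
    have h0 : 0 ≤ Real.log N := Real.log_natCast_nonneg N
    rw [div_le_iff₀ hN0] at hlogN
    have h1 : (64 / l * Real.log N) ^ 2 ≤ m := by
      rw [mul_pow, hm]
      calc _ ≤ K * (volume.real I * N) := by gcongr
        _ = _ := by ring
    have h2 := Real.le_sqrt_of_sq_le h1
    calc Real.log N = l / 64 * (64 / l * Real.log N) := by field_simp
      _ ≤ _ := by gcongr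
  calc _ ≤ N * Real.exp (-(l / 4 * ((m - 1) / 2))) := by
        rw [Measure.real]
        exact ENNReal.toReal_le_of_le_ofReal (by positivity) hunion
    _ = Real.exp (Real.log N + -(l / 4 * ((m - 1) / 2))) := by
        rw [Real.exp_add, Real.exp_log hN0]
    _ ≤ Real.exp (1 + -(l / 32 * √m)) := by
        apply Real.exp_le_exp.2
        -- As `√m ≤ m`, the term `lm/8` dominates both `(l/64)√m` from `log N` and the claimed
        -- `(l/32)√m`.
        have : l * √m ≤ l * m := by
          gcongr
          nlinarith
        nlinarith
    _ = _ := Real.exp_add _ _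

end WignerUpper

theorem lemma5p3 :
    (∀ θ : ℝ, ∃ C c K₀ : ℝ, 0 < C ∧ 0 < c ∧ 0 < K₀ ∧
      ∀ (ν νd : Measure ℝ) [IsProbabilityMeasure ν] [IsProbabilityMeasure νd],
        WignerUpper.IsCenteredWithVariance ν 1 → WignerUpper.IsCenteredWithVariance νd 2 →
        WignerUpper.LogSobolev ν θ → WignerUpper.LogSobolev νd θ →
        ∀ (N : ℕ), 1 ≤ N →
        ∀ (Ω : Type*) [MeasurableSpace Ω] (P : Measure Ω) [IsProbabilityMeasure P]
          (x : Sym2 (Fin N) → Ω → ℝ), WignerUpper.IsWignerFamily P ν νd N x →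
        ∀ I : Set ℝ, I.OrdConnected → Bornology.IsBounded I →
          (Real.log N) ^ 2 / N ≤ volume.real I →
        ∀ K : ℝ, K₀ ≤ K →
          P.real {ω | K * N * volume.real I ≤
              (WignerUpper.eigenvalueCount (fun e => x e ω) I : ℝ)} ≤
            C * Real.exp (-(c * √(K * N * volume.real I)))) ∧
    (∀ δ₀ D : ℝ, 0 < δ₀ → ∃ C c K₀ : ℝ, 0 < C ∧ 0 < c ∧ 0 < K₀ ∧
      ∀ (ν νd : Measure ℝ) [IsProbabilityMeasure ν] [IsProbabilityMeasure νd],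
        WignerUpper.IsCenteredWithVariance ν 1 → WignerUpper.IsCenteredWithVariance νd 2 →
        WignerUpper.GaussianDecay ν δ₀ D → WignerUpper.GaussianDecay νd δ₀ D →
        ∀ (N : ℕ), 1 ≤ N →
        ∀ (Ω : Type*) [MeasurableSpace Ω] (P : Measure Ω) [IsProbabilityMeasure P]
          (x : Sym2 (Fin N) → Ω → ℝ), WignerUpper.IsWignerFamily P ν νd N x →
        ∀ I : Set ℝ, I.OrdConnected → Bornology.IsBounded I →
          (Real.log N) ^ 2 / N ≤ volume.real I →
        ∀ K : ℝ, K₀ ≤ K →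
          P.real {ω | K * N * volume.real I ≤
              (WignerUpper.eigenvalueCount (fun e => x e ω) I : ℝ)} ≤
            C * Real.exp (-(c * √(K * N * volume.real I)))) := by
  constructor
  · intro θ
    -- Herbst's argument needs a nonnegative constant. A logarithmic Sobolev inequality persists
    -- when its constant is increased, so `θ` is replaced by `max θ 0`.
    obtain ⟨C, c, K₀, hC, hc, hK, h⟩ := WignerUpper.eigenvalueCount_tail_of_subgaussianBound
      (le_max_left 1 (max θ 0 / 4))
    exact ⟨C, c, K₀, hC, hc, hK, fun ν νd _ _ hν _ hls _ => h ν νd hν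
      (WignerUpper.subgaussianBound_of_logSobolev (le_max_right θ 0) hν
        (hls.mono (le_max_left θ 0)))⟩
  · intro δ₀ D hδ
    obtain ⟨C, c, K₀, hC, hc, hK, h⟩ := WignerUpper.eigenvalueCount_tail_of_subgaussianBound
      (le_max_left 1 (max D (1 / (4 * δ₀))))
    exact ⟨C, c, K₀, hC, hc, hK, fun ν νd _ _ hν _ hg _ => h ν νd hν
      (WignerUpper.subgaussianBound_of_gaussianDecay hδ hg)⟩
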